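/- **Setting.** All curves are parametrized, $\gamma:[0,1]\to\mathbb R^2$, of class $H^2(0,1)$ (represented by their $C^1([0,1])$ representative, $\gamma_{xx}\in L^2(0,1)$ being the weak second derivative). Such a curve is regular if $\gamma_x\neq 0$ on $[0,1]$; then $\tau=\gamma_x/|\gamma_x|$ is its unit tangent, $k$ its scalar curvature, $\mathrm ds=|\gamma_x|\,\mathrm dx$. Let $L(\gamma)=\int_0^1|\gamma_x|\,\mathrm dx$. A *3-network of class $H^2$* is a triple $\Gamma=\{\gamma^1,\gamma^2,\gamma^3\}$ of $H^2$ curves with $\gamma^1(0)=\gamma^2(0)=\gamma^3(0)$ and $\gamma^1(1)=\gamma^2(1)=\gamma^3(1)$, in which every regular curve is parametrized with constant speed $|\gamma^i_x|\equiv L(\gamma^i)$. The curves need not be regular and may have length zero. Networks $\Gamma_n$ converge to $\Gamma$ weakly in $H^2$ if $\gamma^i_n\rightharpoonup\gamma^i$ weakly in $H^2(0,1;\mathbb R^2)$ for $i=1,2,3$. A *Theta-network* is a 3-network of class $H^2$ whose three curves are regular and such that, for $x=0$ and for $x=1$, the unit tangents $\tau^1(x),\tau^2(x),\tau^3(x)$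 form angles of $120$ degrees in pairs. A *degenerate Theta-network* is a 3-network of class $H^2$ in which one curve has length zero, the other two, $\gamma^i$ and $\gamma^j$, are regular, $\tau^i(0)$ and $\tau^j(0)$ form an angle of $120$ degrees, and $\{\tau^i(1),\tau^j(1)\}=\{\tau^i(0),\tau^j(0)\}$ (so that the four half-tangents at the common point bound sectors of $120,60,120,60$ degrees). For a Theta-network let $F(\Gamma)=\sum_{i=1}^3\Big(\int_{\gamma^i}k^2\,\mathrm ds+L(\gamma^i)\Big)$. For a 3-network $\Gamma$ of class $H^2$ let $\overline F(\Gamma)\in[0,+\infty]$ be $$\overline F(\Gamma)=\sum_{i}\Big(\frac1{L(\gamma^i)^3}\int_0^1|\gamma^i_{xx}|^2\,\mathrm dx+L(\gamma^i)\Big),$$ the sum being over all three curves if $\Gamma$ is a Theta-network and over the two regular curves if $\Gamma$ is a degenerate Theta-network, and let $\overline F(\Gamma)=+\infty$ otherwise. **Theorem.** 1. $\overline F(\Gamma)=F(\Gamma)$ for every Theta-network $\Gamma$. 2. $\overline F$ is the relaxation of $F$ with respect to weak $H^2$ convergence: for every 3-network $\Gamma$ of class $H^2$, $$\overline F(\Gamma)=\inf\Big\{\liminf_{n\to\infty}F(\Gamma_n)\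 :\ \Gamma_n \text{ Theta-networks},\ \Gamma_n\rightharpoonup\Gamma \text{ weakly in } H^2\Big\},$$ where $\inf\emptyset=+\infty$. 3. For every degenerate Theta-network $\Gamma$ there are Theta-networks $\Gamma_n\rightharpoonup\Gamma$ weakly in $H^2$ with $F(\Gamma_n)\to\overline F(\Gamma)$. -/

import Mathlib

open MeasureTheory Filter Topology Set
open scoped ContDiff ENNReal

namespace ThetaNet

/-- The Euclidean plane. -/
abbrev Plane : Type := EuclideanSpace ℝ (Fin 2)

/-- Lebesgue measure on the interval `(0,1)`. -/
noncomputable abbrev unitMeasure : Measure ℝ := volume.restrict (Ioo (0 : ℝ) 1)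

/-- `g` is a weak derivative of `f` on `(0,1)`: integration by parts holds against every
`φ ∈ C_c^∞(0,1)`. It is only used when `f` and `g` are integrable on `(0,1)`. -/
def IsWeakDeriv (f g : ℝ → Plane) : Prop :=
  ∀ φ : ℝ → ℝ, ContDiff ℝ ∞ φ → HasCompactSupport φ → tsupport φ ⊆ Ioo 0 1 →
    ∫ x, deriv φ x • f x ∂unitMeasure = - ∫ x, φ x • g x ∂unitMeasure

/-- A parametrized curve `γ : [0,1] → ℝ²` of class `H²`, given through its `C¹([0,1])`
representative: the derivative `γ'` has a weak derivative in `L²(0,1)`.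
Values outside `[0,1]` are irrelevant. -/
structure H2Curve where
  toFun : ℝ → Plane
  contDiffOn_toFun : ContDiffOn ℝ 1 toFun (Icc 0 1)
  exists_weakDeriv : ∃ g : ℝ → Plane,
    MemLp g 2 unitMeasure ∧ IsWeakDeriv (derivWithin toFun (Icc 0 1)) g

namespace H2Curve

/-- The derivative `γ_x` on `[0,1]` (one-sided at the endpoints). -/
noncomputable def velocity (γ : H2Curve) : ℝ → Plane := derivWithin γ.toFun (Icc 0 1)

/-- The weak second derivative `γ_xx ∈ L²(0,1)`, unique up to a null set. -/
noncomputable def acceleration (γ : H2Curve) : ℝ → Plane := γ.exists_weakDeriv.choose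

/-- `γ_x` vanishes nowhere on `[0,1]`. -/
def Regular (γ : H2Curve) : Prop := ∀ x ∈ Icc (0 : ℝ) 1, γ.velocity x ≠ 0

/-- `L(γ) = ∫₀¹ |γ_x| dx`. -/
noncomputable def length (γ : H2Curve) : ℝ := ∫ x, ‖γ.velocity x‖ ∂unitMeasure

/-- The unit tangent `τ = γ_x / |γ_x|` (used for regular curves). -/
noncomputable def tangent (γ : H2Curve) (x : ℝ) : Plane := ‖γ.velocity x‖⁻¹ • γ.velocity x

/-- The scalar curvature `k`, `∂_s² γ = k ν` with `ν` the anticlockwise rotation of `τ` by `π/2`;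
in the parameter `x` this is `k = det(γ_x, γ_xx) / |γ_x|³` (used for regular curves). -/
noncomputable def curvature (γ : H2Curve) (x : ℝ) : ℝ :=
  (γ.velocity x 0 * γ.acceleration x 1 - γ.velocity x 1 * γ.acceleration x 0)
    / ‖γ.velocity x‖ ^ 3

/-- `∫_γ k² ds`, with `ds = |γ_x| dx`. -/
noncomputable def elasticEnergy (γ : H2Curve) : ℝ :=
  ∫ x, γ.curvature x ^ 2 * ‖γ.velocity x‖ ∂unitMeasure

/-- `L(γ)⁻³ ∫₀¹ |γ_xx|² dx + L(γ)`. -/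
noncomputable def speedEnergy (γ : H2Curve) : ℝ :=
  1 / γ.length ^ 3 * (∫ x, ‖γ.acceleration x‖ ^ 2 ∂unitMeasure) + γ.length

end H2Curve

/-- Weak convergence in `L²(0,1; ℝ²)`. -/
def WeakL2 (f : ℕ → ℝ → Plane) (g : ℝ → Plane) : Prop :=
  ∀ h : ℝ → Plane, MemLp h 2 unitMeasure →
    Tendsto (fun n => ∫ x, inner ℝ (f n x) (h x) ∂unitMeasure) atTop
      (𝓝 (∫ x, inner ℝ (g x) (h x) ∂unitMeasure))

/-- Weak convergence in `H²(0,1; ℝ²)`: the curves and their first and second derivatives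
converge weakly in `L²`. -/
def WeakH2 (γs : ℕ → H2Curve) (γ : H2Curve) : Prop :=
  WeakL2 (fun n => (γs n).toFun) γ.toFun ∧
  WeakL2 (fun n => (γs n).velocity) γ.velocity ∧
  WeakL2 (fun n => (γs n).acceleration) γ.acceleration

/-- A `3`-network of class `H²`: three `H²` curves starting at a common junction `P¹` and ending at
a common junction `P²`. Regular curves are parametrized with constant speed equal to their length;
the curves may fail to be regular and may have length zero. -/
structure Network where
  curve : Fin 3 → H2Curve
  start_eq : ∀ i j, (curve i).toFun 0 = (curve j).toFun 0
  end_eq : ∀ i j, (curve i).toFun 1 = (curve j).toFun 1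
  const_speed : ∀ i, (curve i).Regular →
    ∀ x ∈ Icc (0 : ℝ) 1, ‖(curve i).velocity x‖ = (curve i).length

namespace Network

/-- Theta-network: the three curves are regular and form angles of `120` degrees in pairs at both
junctions. -/
def IsTheta (Γ : Network) : Prop :=
  (∀ i, (Γ.curve i).Regular) ∧
  ∀ i j, i ≠ j →
    InnerProductGeometry.angle ((Γ.curve i).tangent 0) ((Γ.curve j).tangent 0)
      = 2 * Real.pi / 3 ∧
    InnerProductGeometry.angle ((Γ.curve i).tangent 1) ((Γ.curve j).tangent 1)
      = 2 * Real.pi / 3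

/-- "Degenerate" Theta-network: one curve `k` has length zero (so `P¹ = P²`), the other two curves
`i`, `j` are regular, their initial tangents `u`, `v` form an angle of `120` degrees, and their final
tangents are again `u`, `v`, in either order. The four half-tangents leaving the common point are
thus `u`, `v`, `-u`, `-v`, which bound sectors of `120`, `60`, `120`, `60` degrees. -/
def IsDegenerate (Γ : Network) : Prop :=
  ∃ i j k : Fin 3, i ≠ j ∧ i ≠ k ∧ j ≠ k ∧
    (Γ.curve i).Regular ∧ (Γ.curve j).Regular ∧ (Γ.curve k).length = 0 ∧
    InnerProductGeometry.angle ((Γ.curve i).tangent 0) ((Γ.curve j).tangent 0)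
      = 2 * Real.pi / 3 ∧
    ({(Γ.curve i).tangent 1, (Γ.curve j).tangent 1} : Set Plane)
      = {(Γ.curve i).tangent 0, (Γ.curve j).tangent 0}

/-- `F(Γ) = ∑ᵢ ∫_{γⁱ} k² ds + L(γⁱ)` (used for Theta-networks). -/
noncomputable def energy (Γ : Network) : ℝ :=
  ∑ i, ((Γ.curve i).elasticEnergy + (Γ.curve i).length)

open Classical in
/-- The extended functional `F̄` on `3`-networks of class `H²`: the sum over the three curves on
Theta-networks, the sum over the two regular curves on degenerate Theta-networks,
`+∞` otherwise. -/
noncomputable def extendedEnergy (Γ : Network) : ℝ≥0∞ :=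
  if Γ.IsTheta then ENNReal.ofReal (∑ i, (Γ.curve i).speedEnergy)
  else if Γ.IsDegenerate then
    ENNReal.ofReal (∑ i with (Γ.curve i).Regular, (Γ.curve i).speedEnergy)
  else ⊤

/-- Weak `H²` convergence of `3`-networks: curve by curve. -/
def WeakConv (Γs : ℕ → Network) (Γ : Network) : Prop :=
  ∀ i, WeakH2 (fun n => (Γs n).curve i) (Γ.curve i)

end Network

end ThetaNet

namespace ThetaNet

theorem integral_unitMeasure {E : Type*} [NormedAddCommGroup E] [NormedSpace ℝ E] (f : ℝ → E) :
    ∫ x, f x ∂unitMeasure = ∫ x in (0 : ℝ)..1, f x := by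
  rw [intervalIntegral.integral_of_le zero_le_one, integral_Ioc_eq_integral_Ioo]

theorem integrable_unitMeasure_iff {E : Type*} [NormedAddCommGroup E] {f : ℝ → E} :
    Integrable f unitMeasure ↔ IntervalIntegrable f volume 0 1 := by
  rw [intervalIntegrable_iff_integrableOn_Ioo_of_le zero_le_one]; rfl

theorem intervalIntegrable_of_integrable {E : Type*} [NormedAddCommGroup E] {f : ℝ → E}
    (hf : Integrable f unitMeasure) {a b : ℝ} (ha : a ∈ Icc (0 : ℝ) 1) (hb : b ∈ Icc (0 : ℝ) 1) :
    IntervalIntegrable f volume a b :=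
  (integrable_unitMeasure_iff.1 hf).mono_set (by
    rw [uIcc_of_le zero_le_one]; exact ordConnected_Icc.uIcc_subset ha hb)

theorem ae_mem_Ioo : ∀ᵐ x ∂unitMeasure, x ∈ Ioo (0 : ℝ) 1 :=
  ae_restrict_mem measurableSet_Ioo

theorem integrable_of_continuousOn {E : Type*} [NormedAddCommGroup E] {f : ℝ → E}
    (hf : ContinuousOn f (Icc 0 1)) : Integrable f unitMeasure :=
  (hf.integrableOn_Icc).mono_set Ioo_subset_Icc_self

theorem integrable_of_memLp {E : Type*} [NormedAddCommGroup E] {g : ℝ → E}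
    (hg : MemLp g 2 unitMeasure) : Integrable g unitMeasure :=
  hg.integrable (by norm_num)

theorem memLp_of_continuousOn {E : Type*} [NormedAddCommGroup E] {f : ℝ → E}
    (hf : ContinuousOn f (Icc 0 1)) {p : ℝ≥0∞} : MemLp f p unitMeasure := by
  obtain ⟨C, hC⟩ := isCompact_Icc.exists_bound_of_continuousOn hf
  refine MemLp.of_bound ?_ C ?_
  · exact ((hf.mono Ioo_subset_Icc_self).aestronglyMeasurable measurableSet_Ioo)
  · filter_upwards [ae_mem_Ioo] with x hx using hC x (Ioo_subset_Icc_self hx)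

theorem integrable_smul_of_continuousOn {φ : ℝ → ℝ} {g : ℝ → Plane}
    (hφ : ContinuousOn φ (Icc 0 1)) (hg : Integrable g unitMeasure) :
    Integrable (fun x => φ x • g x) unitMeasure := by
  obtain ⟨C, hC⟩ := isCompact_Icc.exists_bound_of_continuousOn hφ
  refine Integrable.bdd_smul (𝕜 := ℝ) (φ := φ) hg (C := C) ?_ ?_
  · exact ((hφ.mono Ioo_subset_Icc_self).aestronglyMeasurable measurableSet_Ioo)
  · filter_upwards [ae_mem_Ioo] with x hx using hC x (Ioo_subset_Icc_self hx)

/-- `f` is on `[0,1]` a primitive of the integrable function `g`. -/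
def IsPrimitive (f g : ℝ → Plane) : Prop :=
  ∀ x ∈ Icc (0 : ℝ) 1, f x = f 0 + ∫ t in (0 : ℝ)..x, g t

theorem continuousOn_primitive {g : ℝ → Plane} (hg : Integrable g unitMeasure) :
    ContinuousOn (fun x => ∫ t in (0 : ℝ)..x, g t) (Icc 0 1) := by
  have h : IntegrableOn g (uIcc 0 1) := by
    rw [uIcc_of_le (zero_le_one' ℝ)]; exact (integrableOn_Icc_iff_integrableOn_Ioo).2 hg
  have := intervalIntegral.continuousOn_primitive_interval h
  rwa [uIcc_of_le (zero_le_one' ℝ)] at this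

/-- Integration by parts against a primitive. -/
theorem integral_deriv_smul_primitive {φ : ℝ → ℝ} (hφ : ContDiff ℝ 1 φ) {g : ℝ → Plane}
    (hg : Integrable g unitMeasure) :
    ∫ x, deriv φ x • (∫ t in (0 : ℝ)..x, g t) ∂unitMeasure
      = φ 1 • ∫ x, g x ∂unitMeasure - ∫ x, φ x • g x ∂unitMeasure := by
  have hφ' : Continuous (deriv φ) := hφ.continuous_deriv le_rfl
  have hint : Integrable (fun x => deriv φ x) unitMeasure :=
    integrable_of_continuousOn hφ'.continuousOn
  have h1 : ∀ x ∈ Ioo (0 : ℝ) 1, deriv φ x • (∫ t in (0 : ℝ)..x, g t)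
      = ∫ t, {p : ℝ × ℝ | p.2 ≤ p.1}.indicator (fun p => deriv φ p.1 • g p.2) (x, t)
          ∂unitMeasure := by
    intro x hx
    have : (fun t => {p : ℝ × ℝ | p.2 ≤ p.1}.indicator (fun p => deriv φ p.1 • g p.2) (x, t))
      = (Iic x).indicator (fun t => deriv φ x • g t) := by
      ext1 t; simp [indicator]
    rw [this, integral_indicator measurableSet_Iic, Measure.restrict_restrict measurableSet_Iic,
      integral_smul, intervalIntegral.integral_of_le hx.1.le]
    congr 3
    ext t; simp only [mem_Ioc, mem_inter_iff, mem_Iic, mem_Ioo]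
    constructor
    · rintro ⟨a, b⟩; exact ⟨b, a, b.trans_lt hx.2⟩
    · rintro ⟨a, b, c⟩; exact ⟨b, a⟩
  have h2 : ∀ t ∈ Ioo (0 : ℝ) 1, ∫ x, {p : ℝ × ℝ | p.2 ≤ p.1}.indicator
      (fun p => deriv φ p.1 • g p.2) (x, t) ∂unitMeasure = (φ 1 - φ t) • g t := by
    intro t ht
    have : (fun x => {p : ℝ × ℝ | p.2 ≤ p.1}.indicator (fun p => deriv φ p.1 • g p.2) (x, t))
      = (Ici t).indicator (fun x => deriv φ x • g t) := by
      ext1 x; simp [indicator]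
    rw [this, integral_indicator measurableSet_Ici, Measure.restrict_restrict measurableSet_Ici,
      integral_smul_const]
    have hs : Ici t ∩ Ioo 0 1 = Ico t 1 := by
      ext x; simp only [mem_Ico, mem_inter_iff, mem_Ici, mem_Ioo]
      constructor
      · rintro ⟨a, b, c⟩; exact ⟨a, c⟩
      · rintro ⟨a, b⟩; exact ⟨a, ht.1.trans_le a, b⟩
    rw [hs, integral_Ico_eq_integral_Ioc, ← intervalIntegral.integral_of_le ht.2.le,
      intervalIntegral.integral_deriv_eq_sub (fun x _ => (hφ.differentiable one_ne_zero x))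
        (hφ'.intervalIntegrable _ _)]
  calc _ = ∫ x, ∫ t, {p : ℝ × ℝ | p.2 ≤ p.1}.indicator (fun p => deriv φ p.1 • g p.2) (x, t)
          ∂unitMeasure ∂unitMeasure :=
        integral_congr_ae (by filter_upwards [ae_mem_Ioo] with x hx using h1 x hx)
    _ = ∫ t, ∫ x, {p : ℝ × ℝ | p.2 ≤ p.1}.indicator (fun p => deriv φ p.1 • g p.2) (x, t)
          ∂unitMeasure ∂unitMeasure := by
        refine integral_integral_swap (f := fun x t =>
          {p : ℝ × ℝ | p.2 ≤ p.1}.indicator (fun p => deriv φ p.1 • g p.2) (x, t)) ?_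
        exact (hint.smul_prod hg).indicator (measurableSet_le measurable_snd measurable_fst)
    _ = ∫ t, (φ 1 • g t - φ t • g t) ∂unitMeasure :=
        integral_congr_ae (by
          filter_upwards [ae_mem_Ioo] with x hx
          rw [h2 x hx, sub_smul])
    _ = _ := by
        have h3 : Integrable (fun t => φ 1 • g t) unitMeasure := hg.smul (φ 1)
        rw [integral_sub h3 (integrable_smul_of_continuousOn hφ.continuous.continuousOn hg),
          integral_smul]

theorem IsPrimitive.integral_deriv_smul {f g : ℝ → Plane} (h : IsPrimitive f g)
    (hg : Integrable g unitMeasure) {φ : ℝ → ℝ} (hφ : ContDiff ℝ 1 φ) :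
    ∫ x, deriv φ x • f x ∂unitMeasure
      = φ 1 • f 1 - φ 0 • f 0 - ∫ x, φ x • g x ∂unitMeasure := by
  have hφ' : Continuous (deriv φ) := hφ.continuous_deriv le_rfl
  have e : ∫ x, deriv φ x • f x ∂unitMeasure
      = ∫ x, (deriv φ x • f 0 + deriv φ x • ∫ t in (0 : ℝ)..x, g t) ∂unitMeasure :=
    integral_congr_ae (by
      filter_upwards [ae_mem_Ioo] with x hx
      rw [h x (Ioo_subset_Icc_self hx), smul_add])
  rw [e, integral_add, integral_deriv_smul_primitive hφ hg, integral_smul_const,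
    integral_unitMeasure (deriv φ), intervalIntegral.integral_deriv_eq_sub
      (fun x _ => (hφ.differentiable one_ne_zero x)) (hφ'.intervalIntegrable _ _),
    h 1 (by simp), integral_unitMeasure g]
  · module
  · exact (integrable_of_continuousOn hφ'.continuousOn).smul_const _
  · exact integrable_of_continuousOn (hφ'.continuousOn.smul (continuousOn_primitive hg))

theorem IsPrimitive.isWeakDeriv {f g : ℝ → Plane} (h : IsPrimitive f g)
    (hg : Integrable g unitMeasure) : IsWeakDeriv f g := by
  intro φ hφ _ hs
  have h0 : φ 0 = 0 := by
    by_contra h0; exact lt_irrefl _ (hs (subset_tsupport _ h0)).1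
  have h1 : φ 1 = 0 := by
    by_contra h0; exact lt_irrefl _ (hs (subset_tsupport _ h0)).2
  rw [h.integral_deriv_smul hg (hφ.of_le (by exact_mod_cast le_top)), h0, h1]
  simp

/-- A smooth function with compact support in `(0,1)` and vanishing integral is the derivative of
a function of the same kind. -/
theorem exists_primitive_test {χ : ℝ → ℝ} (hχ : ContDiff ℝ ∞ χ) (hc : HasCompactSupport χ)
    (hs : tsupport χ ⊆ Ioo 0 1) (h0 : ∫ x in (0 : ℝ)..1, χ x = 0) :
    ∃ φ : ℝ → ℝ, ContDiff ℝ ∞ φ ∧ HasCompactSupport φ ∧ tsupport φ ⊆ Ioo 0 1 ∧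
      deriv φ = χ := by
  have hcont : Continuous χ := hχ.continuous
  obtain ⟨a, b, ha, hb, hab⟩ : ∃ a b : ℝ, 0 < a ∧ b < 1 ∧ ∀ x, χ x ≠ 0 → x ∈ Icc a b := by
    rcases (tsupport χ).eq_empty_or_nonempty with he | hne
    · refine ⟨1, 0, one_pos, one_pos, fun x hx => ?_⟩
      have := subset_tsupport χ hx
      rw [he] at this; exact this.elim
    · obtain ⟨a, haK, ha⟩ := hc.isCompact.exists_isLeast hne
      obtain ⟨b, hbK, hb⟩ := hc.isCompact.exists_isGreatest hne
      exact ⟨a, b, (hs haK).1, (hs hbK).2, fun x hx =>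
        ⟨ha (subset_tsupport χ hx), hb (subset_tsupport χ hx)⟩⟩
  have hd : ∀ x, HasDerivAt (fun x => ∫ t in (0 : ℝ)..x, χ t) (χ x) x := fun x =>
    intervalIntegral.integral_hasDerivAt_right (hcont.intervalIntegrable _ _)
      (hcont.stronglyMeasurableAtFilter _ _) hcont.continuousAt
  have hderiv : deriv (fun x => ∫ t in (0 : ℝ)..x, χ t) = χ := funext fun x => (hd x).deriv
  have hsupp : ∀ x, (∫ t in (0 : ℝ)..x, χ t) ≠ 0 → x ∈ Icc a b := by
    intro x hx
    by_contra hxn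
    apply hx
    rcases lt_or_ge x a with h | h
    · refine intervalIntegral.integral_zero_ae (ae_of_all _ fun t ht => ?_)
      by_contra hne
      have h1 := (hab t hne).1
      have h2 := (uIoc_subset_uIcc ht).2
      exact absurd (h1.trans h2) (not_le.2 (max_lt ha h))
    · have hbx : b < x := by
        by_contra hn; exact hxn ⟨h, not_lt.1 hn⟩
      rw [← intervalIntegral.integral_add_adjacent_intervals (hcont.intervalIntegrable 0 1)
        (hcont.intervalIntegrable 1 x), h0, zero_add]
      refine intervalIntegral.integral_zero_ae (ae_of_all _ fun t ht => ?_)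
      by_contra hne
      have h1 := (hab t hne).2
      have h2 := (uIoc_subset_uIcc ht).1
      exact absurd (h2.trans h1) (not_le.2 (lt_min hb hbx))
  have hts : tsupport (fun x => ∫ t in (0 : ℝ)..x, χ t) ⊆ Icc a b :=
    closure_minimal hsupp isClosed_Icc
  refine ⟨fun x => ∫ t in (0 : ℝ)..x, χ t, ?_, ?_, ?_, hderiv⟩
  · rw [contDiff_infty_iff_deriv]
    exact ⟨fun x => (hd x).differentiableAt, by rwa [hderiv]⟩
  · exact isCompact_Icc.of_isClosed_subset (isClosed_tsupport _) hts
  · exact hts.trans (Icc_subset_Ioo ha hb)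

theorem eq_of_isWeakDeriv_zero {f : ℝ → Plane} (hf : ContinuousOn f (Icc 0 1))
    (h : IsWeakDeriv f 0) : ∀ x ∈ Icc (0 : ℝ) 1, f x = f 0 := by
  obtain ⟨ψ₀, hψs, hψc, hψd, hψr, hψ1⟩ :=
    exists_contDiff_tsupport_subset (n := ⊤) (isOpen_Ioo.mem_nhds
      (show (1 / 2 : ℝ) ∈ Ioo (0 : ℝ) 1 by constructor <;> norm_num))
  have hI : 0 < ∫ x in (0 : ℝ)..1, ψ₀ x := by
    refine intervalIntegral.integral_pos zero_lt_one hψd.continuous.continuousOn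
      (fun x _ => (hψr ⟨x, rfl⟩).1) ⟨1 / 2, by constructor <;> norm_num, by rw [hψ1]; norm_num⟩
  set I := ∫ x in (0 : ℝ)..1, ψ₀ x
  have hint : ∀ ψ : ℝ → ℝ, Continuous ψ → Integrable (fun x => ψ x • f x) unitMeasure :=
    fun ψ hψ => integrable_of_continuousOn (hψ.continuousOn.smul hf)
  set c : Plane := I⁻¹ • ∫ x, ψ₀ x • f x ∂unitMeasure with hc
  have key : ∀ ψ : ℝ → ℝ, ContDiff ℝ ∞ ψ → HasCompactSupport ψ → tsupport ψ ⊆ Ioo 0 1 →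
      ∫ x in Ioo (0 : ℝ) 1, ψ x • (f x - c) = 0 := by
    intro ψ h1 h2 h3
    set m := I⁻¹ * ∫ x in (0 : ℝ)..1, ψ x with hm
    have hsub : tsupport (fun x => ψ x - m * ψ₀ x) ⊆ tsupport ψ ∪ tsupport ψ₀ := by
      refine closure_minimal (fun x hx => ?_) ((isClosed_tsupport _).union (isClosed_tsupport _))
      by_contra hn
      rw [mem_union, not_or] at hn
      apply hx
      simp [image_eq_zero_of_notMem_tsupport hn.1, image_eq_zero_of_notMem_tsupport hn.2]
    obtain ⟨φ, a1, a2, a3, a4⟩ := exists_primitive_test (χ := fun x => ψ x - m * ψ₀ x)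
      (h1.sub (contDiff_const.mul hψd))
      ((h2.isCompact.union hψc.isCompact).of_isClosed_subset (isClosed_tsupport _) hsub)
      (hsub.trans (union_subset h3 hψs)) (by
        rw [intervalIntegral.integral_sub (h1.continuous.intervalIntegrable _ _)
          ((hψd.continuous.intervalIntegrable _ _).const_mul _),
          intervalIntegral.integral_const_mul, hm]
        change _ - _ * I = 0
        field_simp
        ring)
    have h4 := h φ a1 a2 a3
    rw [a4] at h4
    simp only [Pi.zero_apply, smul_zero, integral_zero, neg_zero, sub_smul, mul_smul] at h4
    have h5 : Integrable (fun x => m • ψ₀ x • f x) unitMeasure :=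
      (hint ψ₀ hψd.continuous).smul m
    rw [integral_sub (hint ψ h1.continuous) h5, integral_smul,
      sub_eq_zero] at h4
    simp only [smul_sub]
    rw [integral_sub (hint ψ h1.continuous)
      ((integrable_of_continuousOn h1.continuous.continuousOn).smul_const _), h4,
      integral_smul_const, integral_unitMeasure ψ, hc, hm, smul_smul, mul_comm, sub_self]
  have hae := isOpen_Ioo.ae_eq_zero_of_integral_contDiff_smul_eq_zero (μ := volume)
    (f := fun x => f x - c) (U := Ioo (0 : ℝ) 1)
    (((hf.sub continuousOn_const).mono Ioo_subset_Icc_self).locallyIntegrableOn measurableSet_Ioo)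
    (fun g h1 h2 h3 => by
      rw [← key g h1 h2 h3, setIntegral_eq_integral_of_forall_compl_eq_zero]
      intro x hx
      rw [image_eq_zero_of_notMem_tsupport (fun hn => hx (h3 hn)), zero_smul])
  have hIoo : ∀ x ∈ Ioo (0 : ℝ) 1, f x = c := by
    have h' : f =ᵐ[volume.restrict (Ioo 0 1)] fun _ => c := by
      filter_upwards [ae_restrict_of_ae hae, ae_mem_Ioo] with x h1 h2
      exact sub_eq_zero.1 (h1 h2)
    exact Measure.eqOn_open_of_ae_eq h' isOpen_Ioo (hf.mono Ioo_subset_Icc_self) continuousOn_const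
  have hIcc : EqOn f (fun _ => c) (Icc 0 1) := by
    refine EqOn.of_subset_closure hIoo hf continuousOn_const Ioo_subset_Icc_self ?_
    rw [closure_Ioo zero_ne_one]
  intro x hx
  rw [hIcc hx, hIcc (by simp : (0 : ℝ) ∈ Icc (0 : ℝ) 1)]

/-- A continuous function with an integrable weak derivative is a primitive of it. -/
theorem IsWeakDeriv.isPrimitive {f g : ℝ → Plane} (hf : ContinuousOn f (Icc 0 1))
    (hg : Integrable g unitMeasure) (h : IsWeakDeriv f g) : IsPrimitive f g := by
  have hG := continuousOn_primitive hg
  have hprim : IsPrimitive (fun x => ∫ t in (0 : ℝ)..x, g t) g := fun x _ => by simp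
  have := eq_of_isWeakDeriv_zero (hf.sub hG) (fun φ h1 h2 h3 => by
    have hφ' : Continuous (deriv φ) :=
      (h1.of_le (m := 1) (by exact_mod_cast le_top)).continuous_deriv le_rfl
    have e1 := h φ h1 h2 h3
    have e2 := hprim.isWeakDeriv hg φ h1 h2 h3
    simp only [Pi.sub_apply, smul_sub, Pi.zero_apply, smul_zero, integral_zero, neg_zero]
    have i1 : Integrable (fun x => deriv φ x • f x) unitMeasure :=
      integrable_of_continuousOn (hφ'.continuousOn.smul hf)
    have i2 : Integrable (fun x => deriv φ x • ∫ t in (0 : ℝ)..x, g t) unitMeasure :=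
      integrable_of_continuousOn (hφ'.continuousOn.smul hG)
    rw [integral_sub i1 i2, e1, e2, sub_self])
  intro x hx
  have := this x hx
  simp only [Pi.sub_apply, intervalIntegral.integral_same, sub_zero] at this
  rw [← this]; abel

theorem IsPrimitive.ae_hasDerivAt {f g : ℝ → Plane} (h : IsPrimitive f g)
    (hg : Integrable g unitMeasure) : ∀ᵐ x ∂unitMeasure, HasDerivAt f (g x) x := by
  have := (integrable_unitMeasure_iff.1 hg).ae_hasDerivAt_integral
  filter_upwards [ae_restrict_of_ae this, ae_mem_Ioo] with x hx hm
  have h1 := (hx (by rw [uIcc_of_le zero_le_one]; exact Ioo_subset_Icc_self hm) 0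
    left_mem_uIcc).const_add (f 0)
  refine h1.congr_of_eventuallyEq ?_
  filter_upwards [isOpen_Ioo.mem_nhds hm] with y hy using h y (Ioo_subset_Icc_self hy)

theorem IsPrimitive.ae_eq {f f' g g' : ℝ → Plane} (h : IsPrimitive f g) (h' : IsPrimitive f' g')
    (hg : Integrable g unitMeasure) (hg' : Integrable g' unitMeasure)
    (hff' : EqOn f f' (Icc 0 1)) : g =ᵐ[unitMeasure] g' := by
  filter_upwards [h.ae_hasDerivAt hg, h'.ae_hasDerivAt hg', ae_mem_Ioo] with x h1 h2 hm
  refine h1.unique (h2.congr_of_eventuallyEq ?_)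
  filter_upwards [isOpen_Ioo.mem_nhds hm] with y hy using hff' (Ioo_subset_Icc_self hy)

theorem IsPrimitive.ae_inner_eq_zero {f g : ℝ → Plane} (h : IsPrimitive f g)
    (hg : Integrable g unitMeasure) {c : ℝ} (hc : ∀ x ∈ Icc (0 : ℝ) 1, ‖f x‖ = c) :
    ∀ᵐ x ∂unitMeasure, inner ℝ (f x) (g x) = 0 := by
  filter_upwards [h.ae_hasDerivAt hg, ae_mem_Ioo] with x h1 hm
  have h2 := h1.norm_sq
  have h3 : HasDerivAt (fun y => ‖f y‖ ^ 2) 0 x := by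
    refine (hasDerivAt_const x (c ^ 2)).congr_of_eventuallyEq ?_
    filter_upwards [isOpen_Ioo.mem_nhds hm] with y hy
    rw [hc y (Ioo_subset_Icc_self hy)]
  have := h2.unique h3
  linarith

theorem zero_mem_Icc : (0 : ℝ) ∈ Icc (0 : ℝ) 1 := ⟨le_rfl, zero_le_one⟩

theorem one_mem_Icc : (1 : ℝ) ∈ Icc (0 : ℝ) 1 := ⟨zero_le_one, le_rfl⟩

theorem det_sq_add_inner_sq (v a : Plane) :
    (v 0 * a 1 - v 1 * a 0) ^ 2 + (inner ℝ v a) ^ 2 = ‖v‖ ^ 2 * ‖a‖ ^ 2 := by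
  rw [EuclideanSpace.real_norm_sq_eq, EuclideanSpace.real_norm_sq_eq]
  simp only [PiLp.inner_apply, Fin.sum_univ_two, RCLike.inner_apply, conj_trivial]
  ring

namespace H2Curve

theorem continuousOn_velocity (γ : H2Curve) : ContinuousOn γ.velocity (Icc 0 1) :=
  γ.contDiffOn_toFun.continuousOn_derivWithin (uniqueDiffOn_Icc zero_lt_one) le_rfl

theorem memLp_acceleration (γ : H2Curve) : MemLp γ.acceleration 2 unitMeasure :=
  γ.exists_weakDeriv.choose_spec.1

theorem integrable_acceleration (γ : H2Curve) : Integrable γ.acceleration unitMeasure :=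
  integrable_of_memLp γ.memLp_acceleration

theorem integrable_velocity (γ : H2Curve) : Integrable γ.velocity unitMeasure :=
  integrable_of_continuousOn γ.continuousOn_velocity

theorem isPrimitive_velocity (γ : H2Curve) : IsPrimitive γ.velocity γ.acceleration :=
  IsWeakDeriv.isPrimitive γ.continuousOn_velocity γ.integrable_acceleration
    γ.exists_weakDeriv.choose_spec.2

theorem isPrimitive_toFun (γ : H2Curve) : IsPrimitive γ.toFun γ.velocity := by
  intro x hx
  have hd : DifferentiableOn ℝ γ.toFun (Icc 0 1) :=
    γ.contDiffOn_toFun.differentiableOn one_ne_zero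
  rw [intervalIntegral.integral_eq_sub_of_hasDeriv_right_of_le hx.1
    (hd.continuousOn.mono (Icc_subset_Icc_right hx.2)) (fun t ht => ?_)
    (intervalIntegrable_of_integrable γ.integrable_velocity zero_mem_Icc hx)]
  · abel
  · have hm : t ∈ Ioo (0 : ℝ) 1 := ⟨ht.1, ht.2.trans_le hx.2⟩
    have := (hd t (Ioo_subset_Icc_self hm)).hasDerivWithinAt
    exact (this.hasDerivAt (Icc_mem_nhds hm.1 hm.2)).hasDerivWithinAt

/-- The curve starting at `P` with given velocity `v` and acceleration `g`. -/
noncomputable def ofVelocity (P : Plane) (v g : ℝ → Plane) (hv : Continuous v)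
    (hg : MemLp g 2 unitMeasure) (h : IsPrimitive v g) : H2Curve where
  toFun x := P + ∫ t in (0 : ℝ)..x, v t
  contDiffOn_toFun := by
    have hd : ∀ x, HasDerivAt (fun x => P + ∫ t in (0 : ℝ)..x, v t) (v x) x := fun x =>
      (intervalIntegral.integral_hasDerivAt_right (hv.intervalIntegrable _ _)
        (hv.stronglyMeasurableAtFilter _ _) hv.continuousAt).const_add P
    refine ContDiff.contDiffOn (contDiff_one_iff_deriv.2 ⟨fun x => (hd x).differentiableAt, ?_⟩)
    rwa [funext fun x => (hd x).deriv]
  exists_weakDeriv := by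
    refine ⟨g, hg, ?_⟩
    have hd : ∀ x ∈ Icc (0 : ℝ) 1,
        derivWithin (fun x => P + ∫ t in (0 : ℝ)..x, v t) (Icc 0 1) x = v x := fun x hx =>
      ((intervalIntegral.integral_hasDerivAt_right (hv.intervalIntegrable _ _)
        (hv.stronglyMeasurableAtFilter _ _) hv.continuousAt).const_add P).hasDerivWithinAt.derivWithin
          (uniqueDiffOn_Icc zero_lt_one x hx)
    refine IsPrimitive.isWeakDeriv (fun x hx => ?_) (integrable_of_memLp hg)
    rw [hd x hx, hd 0 zero_mem_Icc, h x hx]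

section ofVelocity

variable (P : Plane) (v g : ℝ → Plane) (hv : Continuous v)
    (hg : MemLp g 2 unitMeasure) (h : IsPrimitive v g)

theorem ofVelocity_toFun (x : ℝ) :
    (ofVelocity P v g hv hg h).toFun x = P + ∫ t in (0 : ℝ)..x, v t := rfl

theorem ofVelocity_velocity {x : ℝ} (hx : x ∈ Icc (0 : ℝ) 1) :
    (ofVelocity P v g hv hg h).velocity x = v x :=
  ((intervalIntegral.integral_hasDerivAt_right (hv.intervalIntegrable _ _)
    (hv.stronglyMeasurableAtFilter _ _) hv.continuousAt).const_add P).hasDerivWithinAt.derivWithin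
      (uniqueDiffOn_Icc zero_lt_one x hx)

theorem ofVelocity_acceleration :
    (ofVelocity P v g hv hg h).acceleration =ᵐ[unitMeasure] g :=
  (isPrimitive_velocity _).ae_eq h (integrable_acceleration _) (integrable_of_memLp hg)
    fun _ hx => ofVelocity_velocity P v g hv hg h hx

end ofVelocity

theorem length_eq_of_const {γ : H2Curve} {c : ℝ} (h : ∀ x ∈ Icc (0 : ℝ) 1, ‖γ.velocity x‖ = c) :
    γ.length = c := by
  have : γ.length = ∫ _, c ∂unitMeasure := integral_congr_ae (by
    filter_upwards [ae_mem_Ioo] with x hx using h x (Ioo_subset_Icc_self hx))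
  rw [this]; simp

theorem length_nonneg (γ : H2Curve) : 0 ≤ γ.length := integral_nonneg fun _ => norm_nonneg _

theorem length_pos {γ : H2Curve} (hr : γ.Regular)
    (h : ∀ x ∈ Icc (0 : ℝ) 1, ‖γ.velocity x‖ = γ.length) : 0 < γ.length := by
  rw [← h 0 zero_mem_Icc]; exact norm_pos_iff.2 (hr 0 zero_mem_Icc)

theorem regular_of_const {γ : H2Curve} {c : ℝ} (hc : 0 < c)
    (h : ∀ x ∈ Icc (0 : ℝ) 1, ‖γ.velocity x‖ = c) : γ.Regular := fun x hx h0 => by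
  have := h x hx
  rw [h0, norm_zero] at this
  exact hc.ne this

theorem velocity_eq_zero_of_length {γ : H2Curve} (h : γ.length = 0) :
    ∀ x ∈ Icc (0 : ℝ) 1, γ.velocity x = 0 := by
  have h1 := (integral_eq_zero_iff_of_nonneg (fun x => norm_nonneg (γ.velocity x))
    γ.integrable_velocity.norm).1 h
  have h2 : EqOn γ.velocity (fun _ => 0) (Ioo 0 1) := by
    refine Measure.eqOn_open_of_ae_eq (μ := volume) ?_ isOpen_Ioo
      (γ.continuousOn_velocity.mono Ioo_subset_Icc_self) continuousOn_const
    filter_upwards [h1] with x hx using norm_eq_zero.1 hx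
  refine EqOn.of_subset_closure h2 γ.continuousOn_velocity continuousOn_const
    Ioo_subset_Icc_self ?_
  rw [closure_Ioo zero_ne_one]

theorem not_regular_of_length {γ : H2Curve} (h : γ.length = 0) : ¬ γ.Regular := fun hr =>
  hr 0 zero_mem_Icc (velocity_eq_zero_of_length h 0 zero_mem_Icc)

theorem elasticEnergy_eq {γ : H2Curve} (hr : γ.Regular)
    (h : ∀ x ∈ Icc (0 : ℝ) 1, ‖γ.velocity x‖ = γ.length) :
    γ.elasticEnergy = 1 / γ.length ^ 3 * ∫ x, ‖γ.acceleration x‖ ^ 2 ∂unitMeasure := by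
  have hL := length_pos hr h
  rw [elasticEnergy, ← integral_const_mul]
  refine integral_congr_ae ?_
  filter_upwards [ae_mem_Ioo, γ.isPrimitive_velocity.ae_inner_eq_zero γ.integrable_acceleration h]
    with x hx h0
  have h1 := det_sq_add_inner_sq (γ.velocity x) (γ.acceleration x)
  have h2 := h x (Ioo_subset_Icc_self hx)
  rw [h0, h2] at h1
  rw [curvature, div_pow, h2]
  field_simp
  linear_combination h1

theorem elasticEnergy_nonneg (γ : H2Curve) : 0 ≤ γ.elasticEnergy :=
  integral_nonneg fun _ => by positivity

end H2Curve

namespace Network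

theorem IsTheta.norm_velocity {Γ : Network} (h : Γ.IsTheta) (i : Fin 3) :
    ∀ x ∈ Icc (0 : ℝ) 1, ‖(Γ.curve i).velocity x‖ = (Γ.curve i).length :=
  Γ.const_speed i (h.1 i)

theorem IsTheta.length_pos {Γ : Network} (h : Γ.IsTheta) (i : Fin 3) :
    0 < (Γ.curve i).length := H2Curve.length_pos (h.1 i) (h.norm_velocity i)

theorem IsTheta.energy_eq {Γ : Network} (h : Γ.IsTheta) :
    Γ.energy = ∑ i, (Γ.curve i).speedEnergy :=
  Finset.sum_congr rfl fun i _ => by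
    rw [H2Curve.elasticEnergy_eq (h.1 i) (h.norm_velocity i), H2Curve.speedEnergy]

theorem IsTheta.extendedEnergy_eq {Γ : Network} (h : Γ.IsTheta) :
    Γ.extendedEnergy = ENNReal.ofReal Γ.energy := by
  rw [extendedEnergy, if_pos h, h.energy_eq]

end Network

theorem integrable_inner_of_memLp {f g : ℝ → Plane} (hf : MemLp f 2 unitMeasure)
    (hg : MemLp g 2 unitMeasure) : Integrable (fun x => inner ℝ (f x) (g x)) unitMeasure :=
  memLp_one_iff_integrable.1 ((innerSL ℝ).memLp_of_bilin 1 hf hg)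

theorem integrable_norm_sq_of_memLp {f : ℝ → Plane} (hf : MemLp f 2 unitMeasure) :
    Integrable (fun x => ‖f x‖ ^ 2) unitMeasure := by
  simpa only [real_inner_self_eq_norm_sq] using integrable_inner_of_memLp hf hf

theorem two_mul_integral_inner_sub_le {f g : ℝ → Plane} (hf : MemLp f 2 unitMeasure)
    (hg : MemLp g 2 unitMeasure) :
    2 * (∫ x, inner ℝ (f x) (g x) ∂unitMeasure) - ∫ x, ‖g x‖ ^ 2 ∂unitMeasure
      ≤ ∫ x, ‖f x‖ ^ 2 ∂unitMeasure := by
  rw [← integral_const_mul, ← integral_sub ((integrable_inner_of_memLp hf hg).const_mul 2)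
    (integrable_norm_sq_of_memLp hg)]
  refine integral_mono (((integrable_inner_of_memLp hf hg).const_mul 2).sub
    (integrable_norm_sq_of_memLp hg)) (integrable_norm_sq_of_memLp hf) fun x => ?_
  have := norm_sub_sq_real (f x) (g x)
  dsimp only
  nlinarith [sq_nonneg ‖f x - g x‖]

theorem sq_integral_norm_le {f : ℝ → Plane} (hf : MemLp f 2 unitMeasure) :
    (∫ x, ‖f x‖ ∂unitMeasure) ^ 2 ≤ ∫ x, ‖f x‖ ^ 2 ∂unitMeasure := by
  have h1 := (integrable_of_memLp hf).norm
  set m := ∫ x, ‖f x‖ ∂unitMeasure with hm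
  have h2 : ∫ x, (2 * m * ‖f x‖ - m ^ 2) ∂unitMeasure = m ^ 2 := by
    rw [integral_sub (h1.const_mul _) (integrable_const _), integral_const_mul, ← hm]
    simp; ring
  rw [← h2]
  refine integral_mono ((h1.const_mul _).sub (integrable_const _))
    (integrable_norm_sq_of_memLp hf) fun x => ?_
  dsimp only
  nlinarith [sq_nonneg (‖f x‖ - m)]

theorem tendsto_of_tendsto_inner {u : ℕ → Plane} {v : Plane}
    (h : ∀ e : Plane, Tendsto (fun n => inner ℝ (u n) e) atTop (𝓝 (inner ℝ v e))) :
    Tendsto u atTop (𝓝 v) := by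
  let b := EuclideanSpace.basisFun (Fin 2) ℝ
  have h1 : ∀ w : Plane, w = ∑ i, inner ℝ w (b i) • b i := fun w => by
    conv_lhs => rw [← b.sum_repr' w]
    simp only [real_inner_comm]
  rw [h1 v, funext fun n => h1 (u n)]
  exact tendsto_finsetSum _ fun i _ => (h (b i)).smul_const _

theorem WeakL2.tendsto_integral_smul {f : ℕ → ℝ → Plane} {g : ℝ → Plane} (h : WeakL2 f g)
    (hf : ∀ n, MemLp (f n) 2 unitMeasure) (hg : MemLp g 2 unitMeasure) {η : ℝ → ℝ}
    (hη : MemLp η 2 unitMeasure) :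
    Tendsto (fun n => ∫ x, η x • f n x ∂unitMeasure) atTop (𝓝 (∫ x, η x • g x ∂unitMeasure)) := by
  have hint : ∀ f : ℝ → Plane, MemLp f 2 unitMeasure →
      Integrable (fun x => η x • f x) unitMeasure := fun f hf =>
    memLp_one_iff_integrable.1 (MemLp.smul (r := 1) hf hη)
  have hin : ∀ (f : ℝ → Plane) (e : Plane), MemLp f 2 unitMeasure →
      inner ℝ (∫ x, η x • f x ∂unitMeasure) e
        = ∫ x, inner ℝ (f x) (η x • e) ∂unitMeasure := fun f e hf => by
    rw [real_inner_comm, ← integral_inner (hint f hf)]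
    simp only [real_inner_smul_right, real_inner_comm]
  refine tendsto_of_tendsto_inner fun e => ?_
  simp only [hin _ e (hf _), hin _ e hg]
  exact h _ (MemLp.smul (r := 2) (memLp_top_const e) hη)

theorem IsPrimitive.apply_zero_eq {f g : ℝ → Plane} (h : IsPrimitive f g)
    (hg : Integrable g unitMeasure) :
    f 0 = ∫ x, f x ∂unitMeasure + ∫ x, (x - 1) • g x ∂unitMeasure := by
  have := h.integral_deriv_smul hg (φ := fun x => x - 1) (by fun_prop)
  simp at this
  rw [this]; abel

namespace WeakH2

variable {γs : ℕ → H2Curve} {γ : H2Curve}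

theorem tendsto_velocity (h : WeakH2 γs γ) {x : ℝ} (hx : x ∈ Icc (0 : ℝ) 1) :
    Tendsto (fun n => (γs n).velocity x) atTop (𝓝 (γ.velocity x)) := by
  obtain ⟨-, h1, h2⟩ := h
  have hv : ∀ γ : H2Curve, MemLp γ.velocity 2 unitMeasure := fun γ =>
    memLp_of_continuousOn γ.continuousOn_velocity
  have t0 : Tendsto (fun n => (γs n).velocity 0) atTop (𝓝 (γ.velocity 0)) := by
    have e : ∀ γ : H2Curve, γ.velocity 0 = ∫ x, (1 : ℝ) • γ.velocity x ∂unitMeasure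
        + ∫ x, (x - 1) • γ.acceleration x ∂unitMeasure := fun γ => by
      simpa using γ.isPrimitive_velocity.apply_zero_eq γ.integrable_acceleration
    simp only [e]
    exact (h1.tendsto_integral_smul (fun n => hv _) (hv _) (memLp_const 1)).add
      (h2.tendsto_integral_smul (fun n => (γs n).memLp_acceleration) γ.memLp_acceleration
        (memLp_of_continuousOn (by fun_prop)))
  have e : ∀ γ : H2Curve, γ.velocity x = γ.velocity 0
      + ∫ t, (Ioc 0 x).indicator (fun _ => (1 : ℝ)) t • γ.acceleration t ∂unitMeasure := fun γ => by
    rw [γ.isPrimitive_velocity x hx]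
    congr 1
    have : (fun t => (Ioc 0 x).indicator (fun _ => (1 : ℝ)) t • γ.acceleration t)
        = (Ioc 0 x).indicator γ.acceleration := by
      ext1 t; by_cases ht : t ∈ Ioc 0 x <;> simp [ht]
    rw [this, integral_unitMeasure, intervalIntegral.integral_of_le hx.1,
      intervalIntegral.integral_of_le zero_le_one, integral_indicator measurableSet_Ioc,
      Measure.restrict_restrict measurableSet_Ioc,
      inter_eq_left.2 (Ioc_subset_Ioc_right hx.2)]
  rw [funext fun n => e (γs n), e γ]
  exact t0.add (h2.tendsto_integral_smul (fun n => (γs n).memLp_acceleration)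
    γ.memLp_acceleration ((memLp_const 1).indicator measurableSet_Ioc))

theorem norm_velocity (h : WeakH2 γs γ)
    (hc : ∀ n, ∀ x ∈ Icc (0 : ℝ) 1, ‖(γs n).velocity x‖ = (γs n).length) :
    ∀ x ∈ Icc (0 : ℝ) 1, ‖γ.velocity x‖ = γ.length := by
  have h0 : ∀ x ∈ Icc (0 : ℝ) 1, ‖γ.velocity x‖ = ‖γ.velocity 0‖ := fun x hx => by
    refine tendsto_nhds_unique (h.tendsto_velocity hx).norm ?_
    simpa only [hc _ x hx, ← hc _ 0 zero_mem_Icc] using (h.tendsto_velocity zero_mem_Icc).norm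
  intro x hx
  rw [h0 x hx, H2Curve.length_eq_of_const h0]

theorem tendsto_length (h : WeakH2 γs γ)
    (hc : ∀ n, ∀ x ∈ Icc (0 : ℝ) 1, ‖(γs n).velocity x‖ = (γs n).length) :
    Tendsto (fun n => (γs n).length) atTop (𝓝 γ.length) := by
  rw [← h.norm_velocity hc 0 zero_mem_Icc]
  simpa only [hc _ 0 zero_mem_Icc] using (h.tendsto_velocity zero_mem_Icc).norm

theorem tendsto_tangent (h : WeakH2 γs γ) {x : ℝ} (hx : x ∈ Icc (0 : ℝ) 1)
    (h0 : γ.velocity x ≠ 0) :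
    Tendsto (fun n => (γs n).tangent x) atTop (𝓝 (γ.tangent x)) :=
  ((h.tendsto_velocity hx).norm.inv₀ (norm_ne_zero_iff.2 h0)).smul (h.tendsto_velocity hx)

/-- Weak lower semicontinuity of the energy of a curve, by a convergent minorant. -/
theorem exists_minorant (h : WeakH2 γs γ)
    (hc : ∀ n, ∀ x ∈ Icc (0 : ℝ) 1, ‖(γs n).velocity x‖ = (γs n).length)
    (hr : ∀ n, (γs n).Regular) (hL : γ.length ≠ 0) :
    ∃ b : ℕ → ℝ, (∀ n, b n ≤ (γs n).elasticEnergy + (γs n).length) ∧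
      Tendsto b atTop (𝓝 γ.speedEnergy) := by
  have hLn := h.tendsto_length hc
  refine ⟨fun n => 1 / (γs n).length ^ 3 *
    (2 * (∫ x, inner ℝ ((γs n).acceleration x) (γ.acceleration x) ∂unitMeasure)
      - ∫ x, ‖γ.acceleration x‖ ^ 2 ∂unitMeasure) + (γs n).length, fun n => ?_, ?_⟩
  · rw [H2Curve.elasticEnergy_eq (hr n) (hc n)]
    have := (γs n).length_nonneg
    have := two_mul_integral_inner_sub_le (γs n).memLp_acceleration γ.memLp_acceleration
    dsimp only
    gcongr
  · have h1 := h.2.2 γ.acceleration γ.memLp_acceleration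
    simp only [real_inner_self_eq_norm_sq] at h1
    have h2 := (((tendsto_const_nhds (x := (1 : ℝ))).div (hLn.pow 3) (pow_ne_zero 3 hL)).mul
      ((h1.const_mul 2).sub_const (∫ x, ‖γ.acceleration x‖ ^ 2 ∂unitMeasure))).add hLn
    convert! h2 using 2
    rw [H2Curve.speedEnergy]; ring

end WeakH2

theorem cos_two_pi_div_three : Real.cos (2 * Real.pi / 3) = -1 / 2 := by
  have : 2 * Real.pi / 3 = Real.pi - Real.pi / 3 := by ring
  rw [this, Real.cos_pi_sub, Real.cos_pi_div_three]; ring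

theorem angle_eq_iff {u v : Plane} (hu : ‖u‖ = 1) (hv : ‖v‖ = 1) :
    InnerProductGeometry.angle u v = 2 * Real.pi / 3 ↔ inner ℝ u v = -1 / 2 := by
  have h := InnerProductGeometry.cos_angle u v
  rw [hu, hv, mul_one, div_one] at h
  constructor
  · intro ha
    rw [← h, ha, cos_two_pi_div_three]
  · intro hi
    have hpi := Real.pi_pos
    refine Real.injOn_cos ⟨InnerProductGeometry.angle_nonneg _ _,
      InnerProductGeometry.angle_le_pi _ _⟩ ⟨by positivity, by linarith⟩ ?_
    rw [h, hi, cos_two_pi_div_three]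

theorem add_add_eq_zero_of_inner {u v w : Plane} (hu : ‖u‖ = 1) (hv : ‖v‖ = 1) (hw : ‖w‖ = 1)
    (huv : inner ℝ u v = (-1 / 2 : ℝ)) (huw : inner ℝ u w = (-1 / 2 : ℝ))
    (hvw : inner ℝ v w = (-1 / 2 : ℝ)) : u + v + w = 0 := by
  rw [← norm_eq_zero, ← sq_eq_zero_iff, norm_add_sq_real, norm_add_sq_real, inner_add_left,
    hu, hv, hw, huv, huw, hvw]
  norm_num

theorem eq_zero_of_det_inner {s z : Plane} (hs : s ≠ 0) (h1 : s 0 * z 1 - s 1 * z 0 = 0)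
    (h2 : inner ℝ s z = (0 : ℝ)) : z = 0 := by
  have := det_sq_add_inner_sq s z
  rw [h1, h2] at this
  have h3 : ‖s‖ ^ 2 ≠ 0 := by simpa using hs
  have h4 : ‖z‖ ^ 2 = 0 := by
    have : ‖s‖ ^ 2 * ‖z‖ ^ 2 = 0 := by rw [← this]; norm_num
    exact (mul_eq_zero.1 this).resolve_left h3
  simpa using h4

/-- In the plane two unit vectors at `120` degrees are determined, up to the order,
by their sum. -/
theorem pair_eq_of_add_eq {u v u' v' : Plane} (hu : ‖u‖ = 1) (hv : ‖v‖ = 1) (hu' : ‖u'‖ = 1)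
    (hv' : ‖v'‖ = 1) (h : inner ℝ u v = (-1 / 2 : ℝ)) (h' : inner ℝ u' v' = (-1 / 2 : ℝ))
    (hs : u' + v' = u + v) : ({u', v'} : Set Plane) = {u, v} := by
  have hs1 : ‖u + v‖ ^ 2 = 1 := by rw [norm_add_sq_real, hu, hv, h]; norm_num
  have hs0 : u + v ≠ 0 := fun h0 => by rw [h0] at hs1; norm_num at hs1
  have hx : ∀ a b : Plane, ‖a‖ = 1 → ‖b‖ = 1 → inner ℝ (a + b) (a - b) = (0 : ℝ) := by
    intro a b ha hb
    rw [inner_add_left, inner_sub_right, inner_sub_right, real_inner_self_eq_norm_sq,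
      real_inner_self_eq_norm_sq, ha, hb, real_inner_comm b a]; ring
  have hx1 : ‖u - v‖ ^ 2 = 3 := by rw [norm_sub_sq_real, hu, hv, h]; norm_num
  have hx1' : ‖u' - v'‖ ^ 2 = 3 := by rw [norm_sub_sq_real, hu', hv', h']; norm_num
  have i1 := hx u v hu hv
  have i2 := hx u' v' hu' hv'
  rw [hs] at i2
  have d1 := det_sq_add_inner_sq (u + v) (u - v)
  have d2 := det_sq_add_inner_sq (u + v) (u' - v')
  rw [i1, hs1, hx1] at d1
  rw [i2, hs1, hx1'] at d2
  have hu2 : ∀ a b : Plane, a = (1 / 2 : ℝ) • ((a + b) + (a - b)) := fun a b => by module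
  have hv2 : ∀ a b : Plane, b = (1 / 2 : ℝ) • ((a + b) - (a - b)) := fun a b => by module
  rcases sq_eq_sq_iff_eq_or_eq_neg.1 (by linarith : ((u + v) 0 * (u' - v') 1
      - (u + v) 1 * (u' - v') 0) ^ 2 = ((u + v) 0 * (u - v) 1 - (u + v) 1 * (u - v) 0) ^ 2)
    with hd | hd
  · have hz : (u' - v') - (u - v) = 0 := by
      refine eq_zero_of_det_inner hs0 ?_ (by rw [inner_sub_right, i1, i2, sub_zero])
      simp only [PiLp.sub_apply] at hd ⊢
      linarith
    have hz := sub_eq_zero.1 hz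
    have e1 : u' = u := by rw [hu2 u' v', hs, hz, ← hu2]
    have e2 : v' = v := by rw [hv2 u' v', hs, hz, ← hv2]
    rw [e1, e2]
  · have hz : (u' - v') + (u - v) = 0 := by
      refine eq_zero_of_det_inner hs0 ?_ (by rw [inner_add_right, i1, i2, add_zero])
      simp only [PiLp.sub_apply, PiLp.add_apply] at hd ⊢
      linarith
    have hz := eq_neg_of_add_eq_zero_left hz
    have e1 : u' = v := by rw [hu2 u' v', hs, hz, ← sub_eq_add_neg, ← hv2]
    have e2 : v' = u := by rw [hv2 u' v', hs, hz, sub_neg_eq_add, ← hu2]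
    rw [e1, e2, pair_comm]

theorem exists_ne_ne (k : Fin 3) : ∃ i j : Fin 3, i ≠ j ∧ i ≠ k ∧ j ≠ k := by
  revert k
  decide

namespace H2Curve

theorem norm_tangent {γ : H2Curve} (hr : γ.Regular) {x : ℝ} (hx : x ∈ Icc (0 : ℝ) 1) :
    ‖γ.tangent x‖ = 1 := by
  rw [tangent, norm_smul, norm_inv, norm_norm, inv_mul_cancel₀ (norm_ne_zero_iff.2 (hr x hx))]

theorem velocity_eq_smul_tangent {γ : H2Curve} (hr : γ.Regular)
    (h : ∀ x ∈ Icc (0 : ℝ) 1, ‖γ.velocity x‖ = γ.length) {x : ℝ} (hx : x ∈ Icc (0 : ℝ) 1) :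
    γ.velocity x = γ.length • γ.tangent x := by
  rw [tangent, ← h x hx, smul_smul, mul_inv_cancel₀ (norm_ne_zero_iff.2 (hr x hx)), one_smul]

theorem norm_velocity_sub_le (γ : H2Curve) {x : ℝ} (hx : x ∈ Icc (0 : ℝ) 1) :
    ‖γ.velocity x - γ.velocity 0‖ ≤ ∫ t, ‖γ.acceleration t‖ ∂unitMeasure := by
  rw [γ.isPrimitive_velocity x hx, add_sub_cancel_left]
  refine (intervalIntegral.norm_integral_le_integral_norm hx.1).trans ?_
  rw [integral_unitMeasure]
  refine intervalIntegral.integral_mono_interval le_rfl hx.1 hx.2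
    (ae_of_all _ fun _ => norm_nonneg _)
    (integrable_unitMeasure_iff.1 γ.integrable_acceleration.norm)

theorem norm_displacement_sub_le (γ : H2Curve) :
    ‖(γ.toFun 1 - γ.toFun 0) - γ.velocity 0‖ ≤ ∫ t, ‖γ.acceleration t‖ ∂unitMeasure := by
  have h1 : (γ.toFun 1 - γ.toFun 0) - γ.velocity 0
      = ∫ x, (γ.velocity x - γ.velocity 0) ∂unitMeasure := by
    rw [integral_sub γ.integrable_velocity (integrable_const _), integral_unitMeasure γ.velocity,
      γ.isPrimitive_toFun 1 one_mem_Icc]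
    simp
  rw [h1]
  have := norm_integral_le_of_norm_le_const (μ := unitMeasure)
    (C := ∫ t, ‖γ.acceleration t‖ ∂unitMeasure)
    (f := fun x => γ.velocity x - γ.velocity 0) (by
      filter_upwards [ae_mem_Ioo] with x hx
      exact γ.norm_velocity_sub_le (Ioo_subset_Icc_self hx))
  simpa using this

theorem sq_integral_norm_acceleration_le {γ : H2Curve} (hr : γ.Regular)
    (h : ∀ x ∈ Icc (0 : ℝ) 1, ‖γ.velocity x‖ = γ.length) :
    (∫ t, ‖γ.acceleration t‖ ∂unitMeasure) ^ 2 ≤ γ.elasticEnergy * γ.length ^ 3 := by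
  refine (sq_integral_norm_le γ.memLp_acceleration).trans_eq ?_
  have := length_pos hr h
  rw [elasticEnergy_eq hr h]
  field_simp

theorem norm_sq_tangent_sub_le {γ : H2Curve} (hr : γ.Regular)
    (h : ∀ x ∈ Icc (0 : ℝ) 1, ‖γ.velocity x‖ = γ.length) {x : ℝ} (hx : x ∈ Icc (0 : ℝ) 1) :
    ‖γ.tangent x - γ.tangent 0‖ ^ 2 ≤ γ.elasticEnergy * γ.length := by
  have hL := length_pos hr h
  have h1 := γ.norm_velocity_sub_le hx
  have h2 := sq_integral_norm_acceleration_le hr h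
  rw [velocity_eq_smul_tangent hr h hx, velocity_eq_smul_tangent hr h zero_mem_Icc, ← smul_sub,
    norm_smul, Real.norm_of_nonneg hL.le] at h1
  have h3 := (pow_le_pow_left₀ (by positivity) h1 2).trans h2
  refine le_of_mul_le_mul_left ?_ (pow_pos hL 2)
  linarith

theorem exists_displacement_eq {γ : H2Curve} (hr : γ.Regular)
    (h : ∀ x ∈ Icc (0 : ℝ) 1, ‖γ.velocity x‖ = γ.length) :
    ∃ r : Plane, γ.toFun 1 - γ.toFun 0 = γ.length • (γ.tangent 0 + r) ∧
      ‖r‖ ^ 2 ≤ γ.elasticEnergy * γ.length := by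
  have hL := length_pos hr h
  have h1 := γ.norm_displacement_sub_le
  have h2 := sq_integral_norm_acceleration_le hr h
  refine ⟨γ.length⁻¹ • ((γ.toFun 1 - γ.toFun 0) - γ.velocity 0), ?_, ?_⟩
  · rw [smul_add, smul_smul, mul_inv_cancel₀ hL.ne', one_smul,
      ← velocity_eq_smul_tangent hr h zero_mem_Icc]
    abel
  · have h3 := (pow_le_pow_left₀ (by positivity) h1 2).trans h2
    rw [norm_smul, norm_inv, Real.norm_of_nonneg hL.le, mul_pow]
    refine le_of_mul_le_mul_left ?_ (pow_pos hL 2)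
    field_simp
    linarith

end H2Curve

namespace Network

theorem IsTheta.inner_tangent {Γ : Network} (h : Γ.IsTheta) {i j : Fin 3} (hij : i ≠ j) :
    inner ℝ ((Γ.curve i).tangent 0) ((Γ.curve j).tangent 0) = (-1 / 2 : ℝ) ∧
    inner ℝ ((Γ.curve i).tangent 1) ((Γ.curve j).tangent 1) = (-1 / 2 : ℝ) :=
  ⟨(angle_eq_iff (H2Curve.norm_tangent (h.1 i) zero_mem_Icc)
      (H2Curve.norm_tangent (h.1 j) zero_mem_Icc)).1 (h.2 i j hij).1,
    (angle_eq_iff (H2Curve.norm_tangent (h.1 i) one_mem_Icc)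
      (H2Curve.norm_tangent (h.1 j) one_mem_Icc)).1 (h.2 i j hij).2⟩

theorem IsTheta.tangent_add {Γ : Network} (h : Γ.IsTheta) {i j k : Fin 3} (hij : i ≠ j)
    (hik : i ≠ k) (hjk : j ≠ k) :
    (Γ.curve i).tangent 0 + (Γ.curve j).tangent 0 + (Γ.curve k).tangent 0 = 0 ∧
    (Γ.curve i).tangent 1 + (Γ.curve j).tangent 1 + (Γ.curve k).tangent 1 = 0 := by
  have n0 := fun i => H2Curve.norm_tangent (h.1 i) zero_mem_Icc
  have n1 := fun i => H2Curve.norm_tangent (h.1 i) one_mem_Icc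
  exact ⟨add_add_eq_zero_of_inner (n0 _) (n0 _) (n0 _) (h.inner_tangent hij).1
      (h.inner_tangent hik).1 (h.inner_tangent hjk).1,
    add_add_eq_zero_of_inner (n1 _) (n1 _) (n1 _) (h.inner_tangent hij).2
      (h.inner_tangent hik).2 (h.inner_tangent hjk).2⟩

theorem elasticEnergy_le_energy (Γ : Network) (i : Fin 3) :
    (Γ.curve i).elasticEnergy ≤ Γ.energy := by
  have : (Γ.curve i).elasticEnergy + (Γ.curve i).length ≤ Γ.energy :=
    Finset.single_le_sum (f := fun i => (Γ.curve i).elasticEnergy + (Γ.curve i).length)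
      (fun i _ => add_nonneg (H2Curve.elasticEnergy_nonneg _) (H2Curve.length_nonneg _))
      (Finset.mem_univ i)
  linarith [(Γ.curve i).length_nonneg]

/-- Two curves of a Theta-network cannot both be short with respect to the energy. -/
theorem IsTheta.not_both_short {Γ : Network} (h : Γ.IsTheta) {i j : Fin 3} (hij : i ≠ j)
    (hi : (Γ.curve i).elasticEnergy * (Γ.curve i).length ≤ (1 / 10) ^ 2)
    (hj : (Γ.curve j).elasticEnergy * (Γ.curve j).length ≤ (1 / 10) ^ 2) : False := by
  obtain ⟨r, h1, h2⟩ := H2Curve.exists_displacement_eq (h.1 i) (h.norm_velocity i)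
  obtain ⟨s, h3, h4⟩ := H2Curve.exists_displacement_eq (h.1 j) (h.norm_velocity j)
  have hr : ‖r‖ ≤ 1 / 10 := le_of_sq_le_sq (h2.trans hi) (by norm_num)
  have hs : ‖s‖ ≤ 1 / 10 := le_of_sq_le_sq (h4.trans hj) (by norm_num)
  rw [Γ.start_eq i j, Γ.end_eq i j, h3] at h1
  have hLi := h.length_pos i
  have hLj := h.length_pos j
  have hu := H2Curve.norm_tangent (h.1 i) zero_mem_Icc
  have hv := H2Curve.norm_tangent (h.1 j) zero_mem_Icc
  have huv := (h.inner_tangent hij).1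
  set u := (Γ.curve i).tangent 0
  set v := (Γ.curve j).tangent 0
  have key : 0 ≤ (Γ.curve i).length * (Γ.curve j).length * inner ℝ (u + r) (v + s) := by
    have : (0 : ℝ) ≤ inner ℝ ((Γ.curve i).length • (u + r)) ((Γ.curve j).length • (v + s)) := by
      rw [h1]; exact real_inner_self_nonneg
    rw [real_inner_smul_left, real_inner_smul_right] at this
    linarith
  have hneg : inner ℝ (u + r) (v + s) < (0 : ℝ) := by
    have e1 := real_inner_le_norm u s
    have e2 := real_inner_le_norm r v
    have e3 := real_inner_le_norm r s
    have e4 : ‖r‖ * ‖s‖ ≤ 1 / 10 * (1 / 10) := by gcongr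
    rw [hu, one_mul] at e1
    rw [hv, mul_one] at e2
    rw [inner_add_left, inner_add_right, inner_add_right, huv]
    linarith
  nlinarith [mul_pos hLi hLj]

theorem isTheta_or_isDegenerate_of_bounded {Γs : ℕ → Network} {Γ : Network}
    (hθ : ∀ n, (Γs n).IsTheta) (hw : WeakConv Γs Γ) {C : ℝ} (hC : ∀ n, (Γs n).energy ≤ C) :
    Γ.IsTheta ∨ Γ.IsDegenerate := by
  have hnv : ∀ i, ∀ x ∈ Icc (0 : ℝ) 1, ‖(Γ.curve i).velocity x‖ = (Γ.curve i).length :=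
    fun i => (hw i).norm_velocity fun n => (hθ n).norm_velocity i
  have hlen : ∀ i, Tendsto (fun n => ((Γs n).curve i).length) atTop (𝓝 (Γ.curve i).length) :=
    fun i => (hw i).tendsto_length fun n => (hθ n).norm_velocity i
  have hreg : ∀ i, (Γ.curve i).length ≠ 0 → (Γ.curve i).Regular := fun i h0 =>
    H2Curve.regular_of_const ((H2Curve.length_nonneg _).lt_of_ne' h0) (hnv i)
  have htan : ∀ i, (Γ.curve i).length ≠ 0 → ∀ x ∈ Icc (0 : ℝ) 1,
      Tendsto (fun n => ((Γs n).curve i).tangent x) atTop (𝓝 ((Γ.curve i).tangent x)) :=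
    fun i h0 x hx => (hw i).tendsto_tangent hx (hreg i h0 x hx)
  have hinner : ∀ i j, i ≠ j → (Γ.curve i).length ≠ 0 → (Γ.curve j).length ≠ 0 →
      inner ℝ ((Γ.curve i).tangent 0) ((Γ.curve j).tangent 0) = (-1 / 2 : ℝ) ∧
      inner ℝ ((Γ.curve i).tangent 1) ((Γ.curve j).tangent 1) = (-1 / 2 : ℝ) := by
    intro i j hij hi hj
    constructor
    · refine tendsto_nhds_unique ((htan i hi 0 zero_mem_Icc).inner (htan j hj 0 zero_mem_Icc)) ?_
      simp only [((hθ _).inner_tangent hij).1, tendsto_const_nhds]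
    · refine tendsto_nhds_unique ((htan i hi 1 one_mem_Icc).inner (htan j hj 1 one_mem_Icc)) ?_
      simp only [((hθ _).inner_tangent hij).2, tendsto_const_nhds]
  have hC0 : 0 ≤ C := (H2Curve.elasticEnergy_nonneg _).trans
    (((Γs 0).elasticEnergy_le_energy 0).trans (hC 0))
  have hel : ∀ n i, ((Γs n).curve i).elasticEnergy * ((Γs n).curve i).length
      ≤ C * ((Γs n).curve i).length := fun n i =>
    mul_le_mul_of_nonneg_right (((Γs n).elasticEnergy_le_energy i).trans (hC n))
      (H2Curve.length_nonneg _)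
  have hsmall : ∀ i, (Γ.curve i).length = 0 →
      Tendsto (fun n => C * ((Γs n).curve i).length) atTop (𝓝 0) := fun i h0 => by
    simpa [h0] using (hlen i).const_mul C
  have hone : ∀ i j, i ≠ j → (Γ.curve i).length = 0 → (Γ.curve j).length ≠ 0 := by
    intro i j hij hi hj
    obtain ⟨n, h1, h2⟩ := (((hsmall i hi).eventually_le_const
      (by norm_num : (0 : ℝ) < (1 / 10) ^ 2)).and ((hsmall j hj).eventually_le_const
      (by norm_num : (0 : ℝ) < (1 / 10) ^ 2))).exists
    exact (hθ n).not_both_short hij ((hel n i).trans h1) ((hel n j).trans h2)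
  by_cases hall : ∀ i, (Γ.curve i).length ≠ 0
  · left
    refine ⟨fun i => hreg i (hall i), fun i j hij => ?_⟩
    have ni := fun x hx => H2Curve.norm_tangent (hreg i (hall i)) (x := x) hx
    have nj := fun x hx => H2Curve.norm_tangent (hreg j (hall j)) (x := x) hx
    exact ⟨(angle_eq_iff (ni 0 zero_mem_Icc) (nj 0 zero_mem_Icc)).2
        (hinner i j hij (hall i) (hall j)).1,
      (angle_eq_iff (ni 1 one_mem_Icc) (nj 1 one_mem_Icc)).2
        (hinner i j hij (hall i) (hall j)).2⟩
  · right
    push Not at hall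
    obtain ⟨k, hk⟩ := hall
    obtain ⟨i, j, hij, hik, hjk⟩  := exists_ne_ne k
    have hi := hone k i hik.symm hk
    have hj := hone k j hjk.symm hk
    have ni := fun x hx => H2Curve.norm_tangent (hreg i hi) (x := x) hx
    have nj := fun x hx => H2Curve.norm_tangent (hreg j hj) (x := x) hx
    refine ⟨i, j, k, hij, hik, hjk, hreg i hi, hreg j hj, hk,
      (angle_eq_iff (ni 0 zero_mem_Icc) (nj 0 zero_mem_Icc)).2 (hinner i j hij hi hj).1, ?_⟩
    refine pair_eq_of_add_eq (ni 0 zero_mem_Icc) (nj 0 zero_mem_Icc) (ni 1 one_mem_Icc)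
      (nj 1 one_mem_Icc) (hinner i j hij hi hj).1 (hinner i j hij hi hj).2 ?_
    have hk0 : Tendsto (fun n => ((Γs n).curve k).tangent 1 - ((Γs n).curve k).tangent 0) atTop
        (𝓝 0) := by
      rw [tendsto_zero_iff_norm_tendsto_zero]
      have hsq : Tendsto (fun n => ‖((Γs n).curve k).tangent 1 - ((Γs n).curve k).tangent 0‖ ^ 2)
          atTop (𝓝 0) :=
        squeeze_zero (fun n => by positivity) (fun n =>
          (H2Curve.norm_sq_tangent_sub_le ((hθ n).1 k) ((hθ n).norm_velocity k)
            one_mem_Icc).trans (hel n k)) (hsmall k hk)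
      simpa using hsq.sqrt
    rw [← sub_eq_zero, ← neg_eq_zero]
    refine tendsto_nhds_unique ?_ hk0
    have ht := (((htan i hi 1 one_mem_Icc).add (htan j hj 1 one_mem_Icc)).sub
      ((htan i hi 0 zero_mem_Icc).add (htan j hj 0 zero_mem_Icc))).neg
    refine ht.congr fun n => ?_
    obtain ⟨e0, e1⟩ := (hθ n).tangent_add hij hik hjk
    rw [add_eq_zero_iff_eq_neg.1 e0, add_eq_zero_iff_eq_neg.1 e1]
    abel

end Network

theorem weakL2_of_tendsto {f : ℕ → ℝ → Plane} {g : ℝ → Plane} {C : ℝ}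
    (hf : ∀ n, ContinuousOn (f n) (Icc 0 1))
    (hC : ∀ n, ∀ x ∈ Icc (0 : ℝ) 1, ‖f n x‖ ≤ C)
    (h : ∀ x ∈ Icc (0 : ℝ) 1, Tendsto (fun n => f n x) atTop (𝓝 (g x))) : WeakL2 f g := by
  intro η hη
  refine tendsto_integral_of_dominated_convergence (fun x => C * ‖η x‖) (fun n => ?_)
    ((integrable_of_memLp hη).norm.const_mul C) (fun n => ?_) ?_
  · exact (integrable_inner_of_memLp (memLp_of_continuousOn (hf n)) hη).aestronglyMeasurable
  · filter_upwards [ae_mem_Ioo] with x hx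
    exact (norm_inner_le_norm _ _).trans (mul_le_mul_of_nonneg_right
      (hC n x (Ioo_subset_Icc_self hx)) (norm_nonneg _))
  · filter_upwards [ae_mem_Ioo] with x hx
    exact (h x (Ioo_subset_Icc_self hx)).inner tendsto_const_nhds

theorem abs_integral_inner_le {f h : ℝ → Plane} (hf : MemLp f 2 unitMeasure)
    (hh : MemLp h 2 unitMeasure) {K t η : ℝ} (hK : ∫ x, ‖f x‖ ^ 2 ∂unitMeasure ≤ K) (ht : 0 < t)
    (hη : ∫ x, ‖h x‖ ^ 2 ∂unitMeasure ≤ t * η) (htK : t * K ≤ η) :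
    |∫ x, inner ℝ (f x) (h x) ∂unitMeasure| ≤ η := by
  have i1 := integrable_norm_sq_of_memLp hf
  have i2 := integrable_norm_sq_of_memLp hh
  have h1 : |∫ x, inner ℝ (f x) (h x) ∂unitMeasure|
      ≤ ∫ x, (t / 2 * ‖f x‖ ^ 2 + (1 / (2 * t)) * ‖h x‖ ^ 2) ∂unitMeasure := by
    refine abs_integral_le_integral_abs.trans ?_
    refine integral_mono (integrable_inner_of_memLp hf hh).abs
      ((i1.const_mul _).add (i2.const_mul _)) fun x => ?_
    refine (abs_real_inner_le_norm _ _).trans ?_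
    have e : t / 2 * ‖f x‖ ^ 2 + (1 / (2 * t)) * ‖h x‖ ^ 2 - ‖f x‖ * ‖h x‖
        = 1 / (2 * t) * (t * ‖f x‖ - ‖h x‖) ^ 2 := by field_simp; ring
    have : 0 ≤ 1 / (2 * t) * (t * ‖f x‖ - ‖h x‖) ^ 2 := by positivity
    linarith
  rw [integral_add (i1.const_mul _) (i2.const_mul _), integral_const_mul, integral_const_mul] at h1
  refine h1.trans ?_
  have h2 : t / 2 * (∫ x, ‖f x‖ ^ 2 ∂unitMeasure) ≤ t / 2 * K := by gcongr
  have h3 : 1 / (2 * t) * (∫ x, ‖h x‖ ^ 2 ∂unitMeasure) ≤ 1 / (2 * t) * (t * η) := by gcongr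
  have h4 : 1 / (2 * t) * (t * η) = η / 2 := by field_simp
  linarith

/-- A sequence bounded in `L²` converges weakly if it does so against continuous functions. -/
theorem weakL2_of_continuous {f : ℕ → ℝ → Plane} {g : ℝ → Plane} {K : ℝ}
    (hf : ∀ n, MemLp (f n) 2 unitMeasure) (hg : MemLp g 2 unitMeasure)
    (hK : ∀ n, ∫ x, ‖f n x‖ ^ 2 ∂unitMeasure ≤ K) (hKg : ∫ x, ‖g x‖ ^ 2 ∂unitMeasure ≤ K)
    (h : ∀ η : ℝ → Plane, Continuous η → (∃ C, ∀ x, ‖η x‖ ≤ C) →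
      Tendsto (fun n => ∫ x, inner ℝ (f n x) (η x) ∂unitMeasure) atTop
        (𝓝 (∫ x, inner ℝ (g x) (η x) ∂unitMeasure))) : WeakL2 f g := by
  intro η hη
  have hK0 : 0 ≤ K := (integral_nonneg fun x => by positivity).trans hKg
  rw [Metric.tendsto_atTop]
  intro ε hε
  set t : ℝ := (ε / 4) / (K + 1) with ht
  have ht0 : 0 < t := by positivity
  have htK : t * K ≤ ε / 4 := by
    rw [ht, div_mul_eq_mul_div, div_le_iff₀ (by positivity)]
    nlinarith
  obtain ⟨η', hc, hη', hcont, hmem⟩ := MemLp.exists_hasCompactSupport_integral_rpow_sub_le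
    (p := 2) (by norm_num) (f := η) (μ := unitMeasure) (by simpa using hη)
    (show 0 < t * (ε / 4) by positivity)
  have hmem : MemLp η' 2 unitMeasure := by simpa using hmem
  simp only [Real.rpow_two] at hη'
  have hbd : ∃ C, ∀ x, ‖η' x‖ ≤ C := hc.exists_bound_of_continuous hcont
  have hsub : ∀ f : ℝ → Plane, MemLp f 2 unitMeasure → ∫ x, ‖f x‖ ^ 2 ∂unitMeasure ≤ K →
      |∫ x, inner ℝ (f x) (η x) ∂unitMeasure - ∫ x, inner ℝ (f x) (η' x) ∂unitMeasure|
        ≤ ε / 4 := by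
    intro f hf hfK
    rw [← integral_sub (integrable_inner_of_memLp hf hη) (integrable_inner_of_memLp hf hmem)]
    simp only [← inner_sub_right]
    exact abs_integral_inner_le hf (hη.sub hmem) hfK ht0 hη' htK
  obtain ⟨N, hN⟩ := Metric.tendsto_atTop.1 (h η' hcont hbd) (ε / 4) (by positivity)
  refine ⟨N, fun n hn => ?_⟩
  have h1 := abs_le.1 (hsub _ (hf n) (hK n))
  have h2 := abs_le.1 (hsub _ hg hKg)
  have h3 := abs_lt.1 (Real.dist_eq _ _ ▸ hN n hn)
  rw [Real.dist_eq, abs_lt]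
  constructor <;> linarith [h1.1, h1.2, h2.1, h2.2, h3.1, h3.2]

/-- A diffeomorphism of the line with derivative `1 + m`, fixing `0` and `1`. -/
structure IsReparam (m : ℝ → ℝ) (e : ℝ ≃o ℝ) : Prop where
  cont : Continuous m
  bound : ∀ x, |m x| ≤ 1 / 2
  apply_eq : ∀ x, e x = x + ∫ t in (0 : ℝ)..x, m t
  apply_one : e 1 = 1

theorem exists_isReparam {m : ℝ → ℝ} (hm : Continuous m) (hb : ∀ x, |m x| ≤ 1 / 2)
    (h1 : ∫ t in (0 : ℝ)..1, m t = 0) : ∃ e : ℝ ≃o ℝ, IsReparam m e := by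
  set q : ℝ → ℝ := fun x => x + ∫ t in (0 : ℝ)..x, m t with hq
  have hd : ∀ x, HasDerivAt q (1 + m x) x := fun x =>
    (hasDerivAt_id x).add (intervalIntegral.integral_hasDerivAt_right (hm.intervalIntegrable _ _)
      (hm.stronglyMeasurableAtFilter _ _) hm.continuousAt)
  have hmono : StrictMono q := strictMono_of_deriv_pos fun x => by
    rw [(hd x).deriv]; linarith [(abs_le.1 (hb x)).1]
  have hlow : Monotone fun x => q x - x / 2 := by
    have hd' : ∀ x, HasDerivAt (fun x => q x - x / 2) (1 + m x - 1 / 2) x := fun x =>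
      (hd x).sub ((hasDerivAt_id x).div_const 2)
    refine monotone_of_deriv_nonneg (fun x => (hd' x).differentiableAt) fun x => ?_
    rw [(hd' x).deriv]
    linarith [(abs_le.1 (hb x)).1]
  have hq0 : q 0 = 0 := by simp [hq]
  have hsurj : Function.Surjective q := by
    refine Continuous.surjective (continuous_iff_continuousAt.2 fun x => (hd x).continuousAt) ?_ ?_
    · refine tendsto_atTop_mono' atTop ?_ (tendsto_id.atTop_div_const (two_pos : (0 : ℝ) < 2))
      filter_upwards [eventually_ge_atTop 0] with x hx
      have := hlow hx
      simp only [hq0] at this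
      dsimp only [id]; linarith
    · refine tendsto_atBot_mono' atBot ?_ (tendsto_id.atBot_div_const (two_pos : (0 : ℝ) < 2))
      filter_upwards [eventually_le_atBot 0] with x hx
      have := hlow hx
      simp only [hq0] at this
      dsimp only [id]; linarith
  refine ⟨hmono.orderIsoOfSurjective q hsurj, hm, hb, fun x => rfl, ?_⟩
  change (1 : ℝ) + ∫ t in (0 : ℝ)..1, m t = 1
  rw [h1, add_zero]

namespace IsReparam

variable {m : ℝ → ℝ} {e : ℝ ≃o ℝ}

theorem apply_zero (h : IsReparam m e) : e 0 = 0 := by simp [h.apply_eq]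

theorem symm_zero (h : IsReparam m e) : e.symm 0 = 0 := by rw [e.symm_apply_eq, h.apply_zero]

theorem symm_one (h : IsReparam m e) : e.symm 1 = 1 := by rw [e.symm_apply_eq, h.apply_one]

theorem pos (h : IsReparam m e) (x : ℝ) : 0 < 1 + m x := by linarith [(abs_le.1 (h.bound x)).1]

theorem inv_le (h : IsReparam m e) (x : ℝ) : (1 + m x)⁻¹ ≤ 2 := by
  rw [inv_le_comm₀ (h.pos x) two_pos]
  linarith [(abs_le.1 (h.bound x)).1]

theorem hasDerivAt (h : IsReparam m e) (x : ℝ) : HasDerivAt e (1 + m x) x := by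
  rw [show (e : ℝ → ℝ) = fun x => x + ∫ t in (0 : ℝ)..x, m t from funext h.apply_eq]
  exact (hasDerivAt_id x).add (intervalIntegral.integral_hasDerivAt_right
    (h.cont.intervalIntegrable _ _) (h.cont.stronglyMeasurableAtFilter _ _) h.cont.continuousAt)

theorem symm_mem (h : IsReparam m e) {y : ℝ} (hy : y ∈ Icc (0 : ℝ) 1) :
    e.symm y ∈ Icc (0 : ℝ) 1 := by
  rw [← h.symm_zero, ← h.symm_one]
  exact ⟨e.symm.monotone hy.1, e.symm.monotone hy.2⟩

variable {E : Type*} [NormedAddCommGroup E] [NormedSpace ℝ E]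

theorem integral_comp (h : IsReparam m e) (f : ℝ → E) {x : ℝ} (hx : 0 ≤ x) :
    ∫ y in (0 : ℝ)..(e x), f y = ∫ t in (0 : ℝ)..x, (1 + m t) • f (e t) := by
  have h0 : 0 ≤ e x := by rw [← h.apply_zero]; exact e.monotone hx
  rw [intervalIntegral.integral_of_le h0, intervalIntegral.integral_of_le hx]
  have := integral_image_eq_integral_abs_deriv_smul (s := Ioc 0 x) measurableSet_Ioc
    (fun x _ => (h.hasDerivAt x).hasDerivWithinAt) e.injective.injOn f
  rw [OrderIso.image_Ioc, h.apply_zero] at this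
  simpa only [abs_of_pos (h.pos _)] using this

theorem integral_unitMeasure_comp (h : IsReparam m e) (f : ℝ → E) :
    ∫ y, f y ∂unitMeasure = ∫ x, (1 + m x) • f (e x) ∂unitMeasure := by
  have := h.integral_comp f zero_le_one
  rwa [h.apply_one, ← integral_unitMeasure, ← integral_unitMeasure] at this

theorem integrable_iff (h : IsReparam m e) (f : ℝ → E) :
    Integrable f unitMeasure ↔ Integrable (fun x => (1 + m x) • f (e x)) unitMeasure := by
  have := integrableOn_image_iff_integrableOn_abs_deriv_smul (s := Ioo 0 1) measurableSet_Ioo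
    (fun x _ => (h.hasDerivAt x).hasDerivWithinAt) e.injective.injOn f
  rw [OrderIso.image_Ioo, h.apply_zero, h.apply_one] at this
  simp only [abs_of_pos (h.pos _)] at this
  exact this

/-- The derivative of `v ∘ e⁻¹`, where `A` is the derivative of `v`. -/
noncomputable def pushDeriv (m : ℝ → ℝ) (e : ℝ ≃o ℝ) (A : ℝ → Plane) (y : ℝ) : Plane :=
  (1 + m (e.symm y))⁻¹ • A (e.symm y)

theorem pushDeriv_apply (A : ℝ → Plane) (x : ℝ) :
    pushDeriv m e A (e x) = (1 + m x)⁻¹ • A x := by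
  simp [pushDeriv]

theorem smul_norm_sq_pushDeriv (h : IsReparam m e) (A : ℝ → Plane) (x : ℝ) :
    (1 + m x) • ‖pushDeriv m e A (e x)‖ ^ 2 = (1 + m x)⁻¹ * ‖A x‖ ^ 2 := by
  have := h.pos x
  rw [pushDeriv_apply, norm_smul, norm_inv, Real.norm_of_nonneg this.le, smul_eq_mul]
  field_simp

theorem integrable_inv_mul (h : IsReparam m e) {A : ℝ → Plane} (hA : MemLp A 2 unitMeasure) :
    Integrable (fun x => (1 + m x)⁻¹ * ‖A x‖ ^ 2) unitMeasure := by
  refine (integrable_norm_sq_of_memLp hA).bdd_mul (c := 2)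
    (Continuous.aestronglyMeasurable ((continuous_const.add h.cont).inv₀
      fun x => (h.pos x).ne')) (ae_of_all _ fun x => ?_)
  rw [norm_inv, Real.norm_of_nonneg (h.pos x).le]
  exact h.inv_le x

theorem memLp_pushDeriv (h : IsReparam m e) {A : ℝ → Plane} (hAm : StronglyMeasurable A)
    (hA : MemLp A 2 unitMeasure) : MemLp (pushDeriv m e A) 2 unitMeasure := by
  have hes : Measurable e.symm := e.symm.continuous.measurable
  have hmeas : StronglyMeasurable (pushDeriv m e A) :=
    ((continuous_const.add h.cont).measurable.inv.comp hes).stronglyMeasurable.smul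
      (hAm.comp_measurable hes)
  rw [memLp_two_iff_integrable_sq_norm hmeas.aestronglyMeasurable, h.integrable_iff]
  simp only [h.smul_norm_sq_pushDeriv]
  exact h.integrable_inv_mul hA

theorem integral_norm_sq_pushDeriv (h : IsReparam m e) (A : ℝ → Plane) :
    ∫ y, ‖pushDeriv m e A y‖ ^ 2 ∂unitMeasure = ∫ x, (1 + m x)⁻¹ * ‖A x‖ ^ 2 ∂unitMeasure := by
  rw [h.integral_unitMeasure_comp]
  simp only [h.smul_norm_sq_pushDeriv]

theorem integral_inner_pushDeriv (h : IsReparam m e) (A η : ℝ → Plane) :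
    ∫ y, inner ℝ (pushDeriv m e A y) (η y) ∂unitMeasure
      = ∫ x, inner ℝ (A x) (η (e x)) ∂unitMeasure := by
  rw [h.integral_unitMeasure_comp]
  refine integral_congr_ae (ae_of_all _ fun x => ?_)
  dsimp only
  rw [pushDeriv_apply, real_inner_smul_left, smul_eq_mul, mul_inv_cancel_left₀ (h.pos x).ne']

theorem isPrimitive_pushDeriv (h : IsReparam m e) {v A : ℝ → Plane} (hv : IsPrimitive v A) :
    IsPrimitive (fun y => v (e.symm y)) (pushDeriv m e A) := by
  intro y hy
  obtain ⟨x, rfl⟩ := e.surjective y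
  have hx : x ∈ Icc (0 : ℝ) 1 := by simpa using h.symm_mem hy
  dsimp only
  rw [h.integral_comp _ hx.1, e.symm_apply_apply, h.symm_zero, hv x hx]
  congr 2
  ext1 t
  rw [pushDeriv_apply, smul_smul, mul_inv_cancel₀ (h.pos t).ne', one_smul]

theorem abs_apply_sub_le (h : IsReparam m e) {δ : ℝ} (hδ : ∀ x, |m x| ≤ δ) {x : ℝ}
    (hx : x ∈ Icc (0 : ℝ) 1) : |e x - x| ≤ δ := by
  rw [h.apply_eq, add_sub_cancel_left]
  have := intervalIntegral.norm_integral_le_of_norm_le_const (a := 0) (b := x) (f := m)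
    fun t _ => hδ t
  rw [sub_zero, abs_of_nonneg hx.1] at this
  have h0 : 0 ≤ δ := (abs_nonneg _).trans (hδ 0)
  exact this.trans (mul_le_of_le_one_right h0 hx.2)

theorem abs_symm_sub_le (h : IsReparam m e) {δ : ℝ} (hδ : ∀ x, |m x| ≤ δ) {y : ℝ}
    (hy : y ∈ Icc (0 : ℝ) 1) : |e.symm y - y| ≤ δ := by
  have := h.abs_apply_sub_le hδ (h.symm_mem hy)
  rwa [e.apply_symm_apply, abs_sub_comm] at this

end IsReparam

namespace H2Curve

/-- The velocity, extended to the line by its boundary values. -/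
noncomputable def extVelocity (γ : H2Curve) (x : ℝ) : Plane :=
  γ.velocity (projIcc (0 : ℝ) 1 zero_le_one x)

theorem continuous_extVelocity (γ : H2Curve) : Continuous γ.extVelocity :=
  (continuousOn_iff_continuous_domRestrict.1 γ.continuousOn_velocity).comp continuous_projIcc

theorem extVelocity_eq (γ : H2Curve) {x : ℝ} (hx : x ∈ Icc (0 : ℝ) 1) :
    γ.extVelocity x = γ.velocity x := by
  rw [extVelocity, projIcc_of_mem _ hx]

theorem hasDerivAt_toFun (γ : H2Curve) {x : ℝ} (hx : x ∈ Ioo (0 : ℝ) 1) :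
    HasDerivAt γ.toFun (γ.velocity x) x :=
  ((γ.contDiffOn_toFun.differentiableOn one_ne_zero) x
    (Ioo_subset_Icc_self hx)).hasDerivWithinAt.hasDerivAt (Icc_mem_nhds hx.1 hx.2)

theorem integral_velocity_eq_zero {γ : H2Curve} (hc : γ.toFun 0 = γ.toFun 1) :
    ∫ x, γ.velocity x ∂unitMeasure = 0 := by
  have := γ.isPrimitive_toFun 1 one_mem_Icc
  rw [← hc] at this
  rw [integral_unitMeasure]
  exact left_eq_add.1 this

/-- A closed regular curve is not contained in a line: the vectors `∫ ⟨α, γ_x⟩ γ_x` fill the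
plane. -/
theorem exists_integral_inner_smul_eq {γ : H2Curve} (hr : γ.Regular)
    (hc : γ.toFun 0 = γ.toFun 1) (w : Plane) :
    ∃ α : Plane, ∫ x, inner ℝ α (γ.velocity x) • γ.velocity x ∂unitMeasure = w := by
  have hcont : ∀ α : Plane, ContinuousOn (fun x => inner ℝ α (γ.velocity x)) (Icc 0 1) := fun α =>
    continuousOn_const.inner γ.continuousOn_velocity
  have hint : ∀ α : Plane,
      Integrable (fun x => inner ℝ α (γ.velocity x) • γ.velocity x) unitMeasure := fun α =>
    integrable_smul_of_continuousOn (hcont α) γ.integrable_velocity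
  let G : Plane →ₗ[ℝ] Plane :=
    { toFun := fun α => ∫ x, inner ℝ α (γ.velocity x) • γ.velocity x ∂unitMeasure
      map_add' := fun α β => by
        simp only [inner_add_left, add_smul]
        exact integral_add (hint α) (hint β)
      map_smul' := fun c α => by
        simp only [real_inner_smul_left, mul_smul, RingHom.id_apply]
        exact integral_smul c _ }
  suffices h : Function.Injective G from LinearMap.injective_iff_surjective.1 h w
  rw [← LinearMap.ker_eq_bot, LinearMap.ker_eq_bot']
  intro α hα
  by_contra hα0
  have h1 : ∫ x, inner ℝ α (γ.velocity x) ^ 2 ∂unitMeasure = (0 : ℝ) := by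
    have : inner ℝ α (G α) = (0 : ℝ) := by rw [hα, inner_zero_right]
    change inner ℝ α (∫ x, inner ℝ α (γ.velocity x) • γ.velocity x ∂unitMeasure) = (0 : ℝ) at this
    rw [← integral_inner (hint α)] at this
    simpa only [real_inner_smul_right, ← sq] using this
  have h2 : EqOn (fun x => inner ℝ α (γ.velocity x)) (fun _ => (0 : ℝ)) (Ioo 0 1) := by
    refine Measure.eqOn_open_of_ae_eq (μ := volume) ?_ isOpen_Ioo
      ((hcont α).mono Ioo_subset_Icc_self) continuousOn_const
    have h3 := (integral_eq_zero_iff_of_nonneg (fun x => sq_nonneg _)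
      (integrable_of_continuousOn ((hcont α).pow 2))).1 h1
    filter_upwards [h3] with x hx using pow_eq_zero_iff two_ne_zero |>.1 hx
  have hcoord : ∀ i : Fin 2, ∀ x ∈ Ioo (0 : ℝ) 1,
      HasDerivAt (fun y => γ.toFun y i) (γ.velocity x i) x := fun i x hx =>
    (EuclideanSpace.proj i : Plane →L[ℝ] ℝ).hasFDerivAt.comp_hasDerivAt x (γ.hasDerivAt_toFun hx)
  have hcoordc : ∀ i : Fin 2, ContinuousOn (fun y => γ.toFun y i) (Icc 0 1) := fun i =>
    (EuclideanSpace.proj i : Plane →L[ℝ] ℝ).continuous.comp_continuousOn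
      γ.contDiffOn_toFun.continuousOn
  obtain ⟨x, hx, hx0⟩ := exists_hasDerivAt_eq_zero
    (f := fun x => α 0 * γ.toFun x 1 - α 1 * γ.toFun x 0)
    (f' := fun x => α 0 * γ.velocity x 1 - α 1 * γ.velocity x 0) zero_lt_one
    ((continuousOn_const.mul (hcoordc 1)).sub (continuousOn_const.mul (hcoordc 0)))
    (by rw [hc]) (fun x hx => ((hcoord 1 x hx).const_mul _).sub ((hcoord 0 x hx).const_mul _))
  exact hr x (Ioo_subset_Icc_self hx) (eq_zero_of_det_inner hα0 hx0 (h2 hx))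

/-- The curve with the velocity `γ_x ∘ e⁻¹` and the same starting point. -/
theorem exists_push {γ : H2Curve} {m : ℝ → ℝ} {e : ℝ ≃o ℝ} (h : IsReparam m e) :
    ∃ σ : H2Curve, (∀ y, σ.toFun y = γ.toFun 0 + ∫ t in (0 : ℝ)..y, γ.extVelocity (e.symm t)) ∧
      (∀ y ∈ Icc (0 : ℝ) 1, σ.velocity y = γ.velocity (e.symm y)) ∧
      ∃ A : ℝ → Plane, γ.acceleration =ᵐ[unitMeasure] A ∧
        σ.acceleration =ᵐ[unitMeasure] IsReparam.pushDeriv m e A := by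
  obtain ⟨A, hAm, hA⟩ := γ.memLp_acceleration.1
  have hA2 : MemLp A 2 unitMeasure := γ.memLp_acceleration.ae_eq hA
  have hprim : IsPrimitive γ.extVelocity A := by
    intro x hx
    rw [γ.extVelocity_eq hx, γ.extVelocity_eq zero_mem_Icc, γ.isPrimitive_velocity x hx]
    congr 1
    refine intervalIntegral.integral_congr_ae ?_
    have := (ae_restrict_iff' measurableSet_Ioo).1 hA
    have h1 : ∀ᵐ t : ℝ, t ≠ 1 := by simp [ae_iff, measure_singleton]
    filter_upwards [this, h1] with t ht ht1 hm
    rw [uIoc_of_le hx.1] at hm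
    exact ht ⟨hm.1, lt_of_le_of_ne (hm.2.trans hx.2) ht1⟩
  have hcont : Continuous fun y => γ.extVelocity (e.symm y) :=
    γ.continuous_extVelocity.comp e.symm.continuous
  refine ⟨ofVelocity (γ.toFun 0) (fun y => γ.extVelocity (e.symm y)) (IsReparam.pushDeriv m e A)
    hcont (h.memLp_pushDeriv hAm hA2) (h.isPrimitive_pushDeriv hprim), fun y => rfl,
    fun y hy => ?_, A, hA, ofVelocity_acceleration _ _ _ _ _ _⟩
  rw [ofVelocity_velocity _ _ _ _ _ _ hy, γ.extVelocity_eq (h.symm_mem hy)]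

/-- A closed curve can be opened by a small displacement of its end point in any direction, without
changing its length nor its end tangents, and with convergence of the energy. -/
theorem exists_opening {γ : H2Curve} (hr : γ.Regular)
    (hs : ∀ x ∈ Icc (0 : ℝ) 1, ‖γ.velocity x‖ = γ.length) (hc : γ.toFun 0 = γ.toFun 1)
    (w : Plane) :
    ∃ ε₀ > 0, ∀ ε : ℕ → ℝ, (∀ n, |ε n| ≤ ε₀) → Tendsto ε atTop (𝓝 0) →
      ∃ σ : ℕ → H2Curve, (∀ n, (σ n).toFun 0 = γ.toFun 0 ∧
        (σ n).toFun 1 = γ.toFun 0 + ε n • w ∧ (σ n).velocity 0 = γ.velocity 0 ∧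
        (σ n).velocity 1 = γ.velocity 1 ∧
        ∀ x ∈ Icc (0 : ℝ) 1, ‖(σ n).velocity x‖ = γ.length) ∧ WeakH2 σ γ ∧
        Tendsto (fun n => (σ n).speedEnergy) atTop (𝓝 γ.speedEnergy) := by
  obtain ⟨α, hα⟩ := exists_integral_inner_smul_eq hr hc w
  have hL := length_pos hr hs
  set M : ℝ := ‖α‖ * γ.length + 1 with hM
  have hM0 : 0 < M := by positivity
  have hVn : ∀ x, ‖γ.extVelocity x‖ = γ.length := fun x => hs _ (projIcc 0 1 zero_le_one x).2
  have hin : ∀ x, |inner ℝ α (γ.extVelocity x)| ≤ M := fun x => by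
    have := abs_real_inner_le_norm α (γ.extVelocity x)
    rw [hVn] at this
    linarith
  have hV0 : ∫ x, γ.extVelocity x ∂unitMeasure = 0 := by
    rw [← integral_velocity_eq_zero hc]
    refine integral_congr_ae ?_
    filter_upwards [ae_mem_Ioo] with x hx using γ.extVelocity_eq (Ioo_subset_Icc_self hx)
  have hVi : Integrable γ.extVelocity unitMeasure :=
    integrable_of_continuousOn γ.continuous_extVelocity.continuousOn
  refine ⟨1 / (2 * M), by positivity, fun ε hε hε0 => ?_⟩
  set m : ℕ → ℝ → ℝ := fun n x => ε n * inner ℝ α (γ.extVelocity x) with hm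
  have hmδ : ∀ n x, |m n x| ≤ |ε n| * M := fun n x => by
    rw [hm, abs_mul]
    exact mul_le_mul_of_nonneg_left (hin x) (abs_nonneg _)
  have hδ0 : Tendsto (fun n => |ε n| * M) atTop (𝓝 0) := by
    simpa using (hε0.abs).mul_const M
  have hmc : ∀ n, Continuous (m n) := fun n =>
    continuous_const.mul (continuous_const.inner γ.continuous_extVelocity)
  have hmb : ∀ n x, |m n x| ≤ 1 / 2 := fun n x => (hmδ n x).trans (by
    have := mul_le_mul_of_nonneg_right (hε n) hM0.le
    refine this.trans_eq ?_
    field_simp)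
  have hmI : ∀ n, ∫ t in (0 : ℝ)..1, m n t = 0 := fun n => by
    rw [← integral_unitMeasure]
    simp only [hm]
    rw [integral_const_mul, integral_inner hVi, hV0, inner_zero_right, mul_zero]
  choose e he using fun n => exists_isReparam (hmc n) (hmb n) (hmI n)
  choose σ hσf hσv A hA hσA using fun n => exists_push (γ := γ) (he n)
  have hnorm : ∀ n, ∀ x ∈ Icc (0 : ℝ) 1, ‖(σ n).velocity x‖ = γ.length := fun n x hx => by
    rw [hσv n x hx]; exact hs _ ((he n).symm_mem hx)
  have hm0 : ∀ x, Tendsto (fun n => m n x) atTop (𝓝 0) := fun x =>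
    squeeze_zero_norm (fun n => hmδ n x) hδ0
  have hesymm : ∀ x ∈ Icc (0 : ℝ) 1, Tendsto (fun n => (e n).symm x) atTop (𝓝 x) := fun x hx => by
    rw [tendsto_iff_norm_sub_tendsto_zero]
    exact squeeze_zero (fun n => norm_nonneg _)
      (fun n => (he n).abs_symm_sub_le (hmδ n) hx) hδ0
  have heapp : ∀ x ∈ Icc (0 : ℝ) 1, Tendsto (fun n => e n x) atTop (𝓝 x) := fun x hx => by
    rw [tendsto_iff_norm_sub_tendsto_zero]
    exact squeeze_zero (fun n => norm_nonneg _)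
      (fun n => (he n).abs_apply_sub_le (hmδ n) hx) hδ0
  have hVt : ∀ x ∈ Icc (0 : ℝ) 1,
      Tendsto (fun n => γ.extVelocity ((e n).symm x)) atTop (𝓝 (γ.extVelocity x)) := fun x hx =>
    (γ.continuous_extVelocity.tendsto x).comp (hesymm x hx)
  have hA2 : ∀ n, MemLp (A n) 2 unitMeasure := fun n => γ.memLp_acceleration.ae_eq (hA n)
  have hsq : ∀ n, ∫ x, ‖(σ n).acceleration x‖ ^ 2 ∂unitMeasure
      = ∫ x, (1 + m n x)⁻¹ * ‖γ.acceleration x‖ ^ 2 ∂unitMeasure := fun n => by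
    have e1 : ∫ x, ‖(σ n).acceleration x‖ ^ 2 ∂unitMeasure
        = ∫ x, ‖IsReparam.pushDeriv (m n) (e n) (A n) x‖ ^ 2 ∂unitMeasure :=
      integral_congr_ae (by filter_upwards [hσA n] with x hx; rw [hx])
    rw [e1, (he n).integral_norm_sq_pushDeriv]
    exact integral_congr_ae (by filter_upwards [hA n] with x hx; rw [hx])
  have hAi := integrable_norm_sq_of_memLp γ.memLp_acceleration
  have hsqt : Tendsto (fun n => ∫ x, ‖(σ n).acceleration x‖ ^ 2 ∂unitMeasure) atTop
      (𝓝 (∫ x, ‖γ.acceleration x‖ ^ 2 ∂unitMeasure)) := by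
    simp only [hsq]
    refine tendsto_integral_of_dominated_convergence (fun x => 2 * ‖γ.acceleration x‖ ^ 2)
      (fun n => ((he n).integrable_inv_mul γ.memLp_acceleration).aestronglyMeasurable)
      (hAi.const_mul 2) (fun n => ae_of_all _ fun x => ?_) (ae_of_all _ fun x => ?_)
    · have h0 : 0 ≤ (1 + m n x)⁻¹ := (inv_pos.2 ((he n).pos x)).le
      rw [Real.norm_of_nonneg (by positivity)]
      exact mul_le_mul_of_nonneg_right ((he n).inv_le x) (by positivity)
    · have h1 := ((hm0 x).const_add 1).inv₀ (by norm_num : (1 : ℝ) + 0 ≠ 0)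
      simpa using h1.mul_const (‖γ.acceleration x‖ ^ 2)
  have hlen : ∀ n, (σ n).length = γ.length := fun n => length_eq_of_const (hnorm n)
  refine ⟨σ, fun n => ⟨by simp [hσf], ?_, ?_, ?_, hnorm n⟩, ⟨?_, ?_, ?_⟩, ?_⟩
  · rw [hσf]
    have := (he n).integral_comp (fun t => γ.extVelocity ((e n).symm t)) zero_le_one
    rw [(he n).apply_one] at this
    simp only [OrderIso.symm_apply_apply] at this
    rw [this, ← integral_unitMeasure, ← hα]
    congr 1
    have h3 : ∫ x, (1 + m n x) • γ.extVelocity x ∂unitMeasure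
        = ∫ x, (γ.extVelocity x + ε n • (inner ℝ α (γ.velocity x) • γ.velocity x))
          ∂unitMeasure := by
      refine integral_congr_ae ?_
      filter_upwards [ae_mem_Ioo] with x hx
      simp only [hm]
      rw [γ.extVelocity_eq (Ioo_subset_Icc_self hx), add_smul, one_smul, mul_smul]
    have h4 : Integrable (fun x => ε n • (inner ℝ α (γ.velocity x) • γ.velocity x))
        unitMeasure := (integrable_smul_of_continuousOn
          (continuousOn_const.inner γ.continuousOn_velocity) γ.integrable_velocity).smul (ε n)
    rw [h3, integral_add hVi h4, hV0, zero_add, integral_smul]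
  · rw [hσv n 0 zero_mem_Icc, (he n).symm_zero]
  · rw [hσv n 1 one_mem_Icc, (he n).symm_one]
  · refine weakL2_of_tendsto (C := ‖γ.toFun 0‖ + γ.length)
      (fun n => (σ n).contDiffOn_toFun.continuousOn) (fun n x hx => ?_) (fun x hx => ?_)
    · rw [hσf]
      refine (norm_add_le _ _).trans (add_le_add_right ?_ _)
      refine (intervalIntegral.norm_integral_le_of_norm_le_const
        (fun t _ => (hVn ((e n).symm t)).le)).trans ?_
      rw [sub_zero, abs_of_nonneg hx.1]
      exact mul_le_of_le_one_right hL.le hx.2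
    · simp only [hσf]
      rw [γ.isPrimitive_toFun x hx]
      refine Tendsto.const_add _ ?_
      have h5 : ∫ t in (0 : ℝ)..x, γ.velocity t = ∫ t in (0 : ℝ)..x, γ.extVelocity t :=
        intervalIntegral.integral_congr fun t ht => by
          rw [uIcc_of_le hx.1] at ht
          exact (γ.extVelocity_eq ⟨ht.1, ht.2.trans hx.2⟩).symm
      rw [h5]
      refine intervalIntegral.tendsto_integral_filter_of_dominated_convergence
        (fun _ => γ.length) (Eventually.of_forall fun n =>
          (γ.continuous_extVelocity.comp (e n).symm.continuous).aestronglyMeasurable)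
        (Eventually.of_forall fun n => ae_of_all _ fun t _ => (hVn _).le)
        intervalIntegrable_const (ae_of_all _ fun t ht => ?_)
      rw [uIoc_of_le hx.1] at ht
      exact hVt t ⟨ht.1.le, ht.2.trans hx.2⟩
  · refine weakL2_of_tendsto (C := γ.length) (fun n => (σ n).continuousOn_velocity)
      (fun n x hx => (hnorm n x hx).le) (fun x hx => ?_)
    have := hVt x hx
    rw [γ.extVelocity_eq hx] at this
    refine this.congr fun n => ?_
    rw [hσv n x hx, γ.extVelocity_eq ((he n).symm_mem hx)]
  · refine weakL2_of_continuous (K := 2 * ∫ x, ‖γ.acceleration x‖ ^ 2 ∂unitMeasure)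
      (fun n => (σ n).memLp_acceleration) γ.memLp_acceleration (fun n => ?_) ?_ ?_
    · rw [hsq, ← integral_const_mul]
      exact integral_mono ((he n).integrable_inv_mul γ.memLp_acceleration) (hAi.const_mul 2)
        fun x => mul_le_mul_of_nonneg_right ((he n).inv_le x) (by positivity)
    · have : 0 ≤ ∫ x, ‖γ.acceleration x‖ ^ 2 ∂unitMeasure :=
        integral_nonneg fun x => by positivity
      linarith
    · rintro η hη ⟨C, hC⟩
      have h6 : ∀ n, ∫ x, inner ℝ ((σ n).acceleration x) (η x) ∂unitMeasure
          = ∫ x, inner ℝ (γ.acceleration x) (η (e n x)) ∂unitMeasure := fun n => by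
        have e1 : ∫ x, inner ℝ ((σ n).acceleration x) (η x) ∂unitMeasure
            = ∫ x, inner ℝ (IsReparam.pushDeriv (m n) (e n) (A n) x) (η x) ∂unitMeasure :=
          integral_congr_ae (by filter_upwards [hσA n] with x hx; rw [hx])
        rw [e1, (he n).integral_inner_pushDeriv]
        exact integral_congr_ae (by filter_upwards [hA n] with x hx; rw [hx])
      simp only [h6]
      refine tendsto_integral_of_dominated_convergence (fun x => ‖γ.acceleration x‖ * C)
        (fun n => ?_) (γ.integrable_acceleration.norm.mul_const C)
        (fun n => ae_of_all _ fun x => ?_) ?_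
      · exact (integrable_inner_of_memLp γ.memLp_acceleration (memLp_of_continuousOn
          (hη.comp (e n).continuous).continuousOn)).aestronglyMeasurable
      · exact (norm_inner_le_norm _ _).trans
          (mul_le_mul_of_nonneg_left (hC _) (norm_nonneg _))
      · filter_upwards [ae_mem_Ioo] with x hx
        exact tendsto_const_nhds.inner ((hη.tendsto x).comp (heapp x (Ioo_subset_Icc_self hx)))
  · simp only [speedEnergy, hlen]
    exact (hsqt.const_mul _).add_const _

/-- Segments shrinking to a curve of length zero. -/
theorem exists_segments {γ : H2Curve} (h0 : γ.length = 0) (w : Plane) (ε : ℕ → ℝ)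
    (hε : Tendsto ε atTop (𝓝 0)) :
    ∃ σ : ℕ → H2Curve, (∀ n, (σ n).toFun 0 = γ.toFun 0 ∧
      (σ n).toFun 1 = γ.toFun 0 + ε n • w ∧ (∀ x ∈ Icc (0 : ℝ) 1, (σ n).velocity x = ε n • w)) ∧
      WeakH2 σ γ ∧ Tendsto (fun n => (σ n).speedEnergy) atTop (𝓝 0) := by
  have hprim : ∀ u : Plane, IsPrimitive (fun _ => u) (fun _ => 0) := fun u x _ => by simp
  have hz : MemLp (fun _ : ℝ => (0 : Plane)) 2 unitMeasure := memLp_const 0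
  let σ : ℕ → H2Curve := fun n =>
    ofVelocity (γ.toFun 0) (fun _ => ε n • w) (fun _ => 0) continuous_const hz (hprim _)
  have hv : ∀ n, ∀ x ∈ Icc (0 : ℝ) 1, (σ n).velocity x = ε n • w := fun n x hx =>
    ofVelocity_velocity _ _ _ _ _ _ hx
  have ha : ∀ n, (σ n).acceleration =ᵐ[unitMeasure] fun _ => 0 := fun n =>
    ofVelocity_acceleration _ _ _ _ _ _
  have hγv := velocity_eq_zero_of_length h0
  have hγa : γ.acceleration =ᵐ[unitMeasure] fun _ => 0 :=
    γ.isPrimitive_velocity.ae_eq (hprim 0) γ.integrable_acceleration (integrable_zero _ _ _) hγv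
  have hf : ∀ n x, (σ n).toFun x = γ.toFun 0 + x • ε n • w := fun n x => by
    simp [σ, ofVelocity_toFun, smul_comm x]
  have hw : Tendsto (fun n => ε n • w) atTop (𝓝 0) := by simpa using hε.smul_const w
  obtain ⟨C, hC⟩ := hw.norm.bddAbove_range
  have hC : ∀ n, ‖ε n • w‖ ≤ C := fun n => hC ⟨n, rfl⟩
  refine ⟨σ, fun n => ⟨by simp [hf], by simp [hf], hv n⟩, ⟨?_, ?_, ?_⟩, ?_⟩
  · refine weakL2_of_tendsto (C := ‖γ.toFun 0‖ + C)
      (fun n => (σ n).contDiffOn_toFun.continuousOn) (fun n x hx => ?_) (fun x hx => ?_)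
    · rw [hf]
      refine (norm_add_le _ _).trans (add_le_add_right ?_ _)
      rw [norm_smul, Real.norm_of_nonneg hx.1]
      exact (mul_le_of_le_one_left (norm_nonneg _) hx.2).trans (hC n)
    · have h1 : γ.toFun x = γ.toFun 0 + x • (0 : Plane) := by
        rw [γ.isPrimitive_toFun x hx, intervalIntegral.integral_congr (g := fun _ => (0 : Plane))]
        · simp
        · intro t ht
          rw [uIcc_of_le hx.1] at ht
          exact hγv t ⟨ht.1, ht.2.trans hx.2⟩
      simp only [hf]
      rw [h1]
      exact (hw.const_smul x).const_add _
  · refine weakL2_of_tendsto (C := C) (fun n => (σ n).continuousOn_velocity)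
      (fun n x hx => ?_) (fun x hx => ?_)
    · rw [hv n x hx]; exact hC n
    · rw [hγv x hx]
      exact hw.congr fun n => (hv n x hx).symm
  · intro η _
    have e1 : ∀ f : ℝ → Plane, f =ᵐ[unitMeasure] (fun _ => 0) →
        ∫ x, inner ℝ (f x) (η x) ∂unitMeasure = 0 := fun f hf => by
      rw [integral_congr_ae (g := fun _ => (0 : ℝ))]
      · simp
      · filter_upwards [hf] with x hx
        rw [hx, inner_zero_left]
    simp only [e1 _ (ha _), e1 _ hγa, tendsto_const_nhds]
  · have e1 : ∀ n, (σ n).speedEnergy = ‖ε n • w‖ := fun n => by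
      have e2 : ∫ x, ‖(σ n).acceleration x‖ ^ 2 ∂unitMeasure = 0 := by
        rw [integral_congr_ae (g := fun _ => (0 : ℝ))]
        · simp
        · filter_upwards [ha n] with x hx
          rw [hx]; simp
      rw [speedEnergy, e2, length_eq_of_const (c := ‖ε n • w‖) fun x hx => by rw [hv n x hx]]
      simp
    simp only [e1]
    simpa using hw.norm

end H2Curve

namespace H2Curve

theorem tangent_eq_of_velocity_eq {γ σ : H2Curve} {x : ℝ} (h : σ.velocity x = γ.velocity x) :
    σ.tangent x = γ.tangent x := by
  rw [tangent, tangent, h]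

theorem tangent_of_velocity_eq_smul {σ : H2Curve} {x c : ℝ} {w : Plane} (hc : 0 < c)
    (hw : ‖w‖ = 1) (h : σ.velocity x = c • w) : σ.tangent x = w := by
  rw [tangent, h, norm_smul, hw, Real.norm_of_nonneg hc.le, mul_one, smul_smul,
    inv_mul_cancel₀ hc.ne', one_smul]

end H2Curve

namespace Network

theorem isTheta_of_inner {Γ : Network} (hr : ∀ i, (Γ.curve i).Regular)
    (h : ∀ i j, i ≠ j →
      inner ℝ ((Γ.curve i).tangent 0) ((Γ.curve j).tangent 0) = (-1 / 2 : ℝ) ∧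
      inner ℝ ((Γ.curve i).tangent 1) ((Γ.curve j).tangent 1) = (-1 / 2 : ℝ)) : Γ.IsTheta :=
  ⟨hr, fun i j hij =>
    ⟨(angle_eq_iff (H2Curve.norm_tangent (hr i) zero_mem_Icc)
      (H2Curve.norm_tangent (hr j) zero_mem_Icc)).2 (h i j hij).1,
    (angle_eq_iff (H2Curve.norm_tangent (hr i) one_mem_Icc)
      (H2Curve.norm_tangent (hr j) one_mem_Icc)).2 (h i j hij).2⟩⟩

theorem eq_or_eq_or_eq {i j k : Fin 3} (hij : i ≠ j) (hik : i ≠ k) (hjk : j ≠ k) (l : Fin 3) :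
    l = i ∨ l = j ∨ l = k := by
  omega

/-- Three unit vectors, two of them at `120` degrees and the third opposite to their sum. -/
theorem inner_of_pair {T : Fin 3 → Plane} {i j k : Fin 3} (hij : i ≠ j) (hik : i ≠ k)
    (hjk : j ≠ k) (hi : ‖T i‖ = 1) (hj : ‖T j‖ = 1) (h : inner ℝ (T i) (T j) = (-1 / 2 : ℝ))
    (hk : T k = -(T i + T j)) (l l' : Fin 3) (hl : l ≠ l') :
    inner ℝ (T l) (T l') = (-1 / 2 : ℝ) := by
  have hik' : inner ℝ (T i) (T k) = (-1 / 2 : ℝ) := by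
    rw [hk, inner_neg_right, inner_add_right, real_inner_self_eq_norm_sq, hi, h]; norm_num
  have hjk' : inner ℝ (T j) (T k) = (-1 / 2 : ℝ) := by
    rw [hk, inner_neg_right, inner_add_right, real_inner_self_eq_norm_sq, hj, real_inner_comm, h]
    norm_num
  rcases eq_or_eq_or_eq hij hik hjk l with rfl | rfl | rfl <;>
  rcases eq_or_eq_or_eq hij hik hjk l' with rfl | rfl | rfl <;>
  first
    | exact absurd rfl hl
    | assumption
    | (rw [real_inner_comm]; assumption)

theorem IsDegenerate.not_isTheta {Γ : Network} (h : Γ.IsDegenerate) : ¬ Γ.IsTheta := by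
  obtain ⟨i, j, k, -, -, -, -, -, hk, -⟩ := h
  exact fun hθ => H2Curve.not_regular_of_length hk (hθ.1 k)

theorem IsDegenerate.extendedEnergy_eq {Γ : Network} (h : Γ.IsDegenerate) {i j k : Fin 3}
    (hij : i ≠ j) (hik : i ≠ k) (hjk : j ≠ k) (hi : (Γ.curve i).Regular)
    (hj : (Γ.curve j).Regular) (hk : (Γ.curve k).length = 0) :
    Γ.extendedEnergy
      = ENNReal.ofReal (∑ l, if l = k then 0 else (Γ.curve l).speedEnergy) := by
  classical
  rw [extendedEnergy, if_neg h.not_isTheta, if_pos h, Finset.sum_filter]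
  congr 1
  refine Finset.sum_congr rfl fun l _ => ?_
  rcases eq_or_eq_or_eq hij hik hjk l with rfl | rfl | rfl
  · rw [if_pos hi, if_neg hik]
  · rw [if_pos hj, if_neg hjk]
  · rw [if_neg (H2Curve.not_regular_of_length hk), if_pos rfl]

/-- Recovery sequence of a degenerate Theta-network: the two loops are opened and joined by a
short segment. -/
theorem IsDegenerate.exists_recovery {Γ : Network} (h : Γ.IsDegenerate) :
    ∃ Γs : ℕ → Network, (∀ n, (Γs n).IsTheta) ∧ WeakConv Γs Γ ∧
      Tendsto (fun n => ENNReal.ofReal (Γs n).energy) atTop (𝓝 Γ.extendedEnergy) := by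
  obtain ⟨i, j, k, hij, hik, hjk, hi, hj, hk, hang, hset⟩ := id h
  have ni := fun x hx => H2Curve.norm_tangent hi (x := x) hx
  have nj := fun x hx => H2Curve.norm_tangent hj (x := x) hx
  have hin := (angle_eq_iff (ni 0 zero_mem_Icc) (nj 0 zero_mem_Icc)).1 hang
  have hend : inner ℝ ((Γ.curve i).tangent 1) ((Γ.curve j).tangent 1) = (-1 / 2 : ℝ) ∧
      (Γ.curve i).tangent 1 + (Γ.curve j).tangent 1
        = (Γ.curve i).tangent 0 + (Γ.curve j).tangent 0 := by
    rcases Set.pair_eq_pair_iff.1 hset with ⟨e1, e2⟩ | ⟨e1, e2⟩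
    · rw [e1, e2]; exact ⟨hin, rfl⟩
    · rw [e1, e2, real_inner_comm]; exact ⟨hin, add_comm _ _⟩
  set w : Plane := -((Γ.curve i).tangent 0 + (Γ.curve j).tangent 0) with hw
  have hw1 : ‖w‖ = 1 := by
    rw [hw, norm_neg, ← sq_eq_sq₀ (norm_nonneg _) zero_le_one, norm_add_sq_real,
      ni 0 zero_mem_Icc, nj 0 zero_mem_Icc, hin]
    norm_num
  have hloop : ∀ l, (Γ.curve l).toFun 0 = (Γ.curve l).toFun 1 := fun l => by
    rw [Γ.start_eq l k, Γ.end_eq l k, (Γ.curve k).isPrimitive_toFun 1 one_mem_Icc,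
      intervalIntegral.integral_congr (g := fun _ => (0 : Plane))]
    · simp
    · intro t ht
      rw [uIcc_of_le zero_le_one] at ht
      exact H2Curve.velocity_eq_zero_of_length hk t ht
  obtain ⟨ε₁, hε₁, H1⟩ := H2Curve.exists_opening hi (Γ.const_speed i hi) (hloop i) w
  obtain ⟨ε₂, hε₂, H2⟩ := H2Curve.exists_opening hj (Γ.const_speed j hj) (hloop j) w
  set ε : ℕ → ℝ := fun n => min ε₁ ε₂ * (1 / ((n : ℝ) + 1)) with hεdef
  have hmin : 0 < min ε₁ ε₂ := lt_min hε₁ hε₂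
  have hεpos : ∀ n, 0 < ε n := fun n => by positivity
  have hεle : ∀ n, |ε n| ≤ min ε₁ ε₂ := fun n => by
    rw [abs_of_pos (hεpos n)]
    refine mul_le_of_le_one_right hmin.le ?_
    rw [div_le_one (by positivity)]
    linarith [(Nat.cast_nonneg n : (0 : ℝ) ≤ n)]
  have hε0 : Tendsto ε atTop (𝓝 0) := by
    simpa only [mul_zero] using
      (tendsto_one_div_add_atTop_nhds_zero_nat (𝕜 := ℝ)).const_mul (min ε₁ ε₂)
  have hall : ∀ l, ∃ σ : ℕ → H2Curve, (∀ n, (σ n).toFun 0 = (Γ.curve k).toFun 0 ∧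
      (σ n).toFun 1 = (Γ.curve k).toFun 0 + ε n • w ∧
      (∃ c > 0, ∀ x ∈ Icc (0 : ℝ) 1, ‖(σ n).velocity x‖ = c) ∧
      (σ n).tangent 0 = (if l = k then w else (Γ.curve l).tangent 0) ∧
      (σ n).tangent 1 = (if l = k then w else (Γ.curve l).tangent 1)) ∧
      WeakH2 σ (Γ.curve l) ∧ Tendsto (fun n => (σ n).speedEnergy) atTop
        (𝓝 (if l = k then 0 else (Γ.curve l).speedEnergy)) := by
    intro l
    by_cases hlk : l = k
    · subst hlk
      simp only [if_true]
      obtain ⟨σ, h1, h2, h3⟩ := H2Curve.exists_segments hk w ε hε0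
      refine ⟨σ, fun n => ⟨(h1 n).1, (h1 n).2.1, ⟨ε n, hεpos n, fun x hx => ?_⟩, ?_, ?_⟩, h2, h3⟩
      · rw [(h1 n).2.2 x hx, norm_smul, hw1, mul_one, Real.norm_of_nonneg (hεpos n).le]
      · exact H2Curve.tangent_of_velocity_eq_smul (hεpos n) hw1 ((h1 n).2.2 0 zero_mem_Icc)
      · exact H2Curve.tangent_of_velocity_eq_smul (hεpos n) hw1 ((h1 n).2.2 1 one_mem_Icc)
    · simp only [if_neg hlk]
      have key : (Γ.curve l).Regular ∧ ∃ σ : ℕ → H2Curve,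
          (∀ n, (σ n).toFun 0 = (Γ.curve l).toFun 0 ∧
          (σ n).toFun 1 = (Γ.curve l).toFun 0 + ε n • w ∧
          (σ n).velocity 0 = (Γ.curve l).velocity 0 ∧
          (σ n).velocity 1 = (Γ.curve l).velocity 1 ∧
          ∀ x ∈ Icc (0 : ℝ) 1, ‖(σ n).velocity x‖ = (Γ.curve l).length) ∧
          WeakH2 σ (Γ.curve l) ∧
          Tendsto (fun n => (σ n).speedEnergy) atTop (𝓝 (Γ.curve l).speedEnergy) := by
        rcases eq_or_eq_or_eq hij hik hjk l with rfl | rfl | rfl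
        · exact ⟨hi, H1 ε (fun n => (hεle n).trans (min_le_left _ _)) hε0⟩
        · exact ⟨hj, H2 ε (fun n => (hεle n).trans (min_le_right _ _)) hε0⟩
        · exact absurd rfl hlk
      obtain ⟨hl, σ, h1, h2, h3⟩ := key
      refine ⟨σ, fun n => ?_, h2, h3⟩
      obtain ⟨a1, a2, a3, a4, a5⟩ := h1 n
      exact ⟨a1.trans (Γ.start_eq l k), by rw [a2, Γ.start_eq l k],
        ⟨_, H2Curve.length_pos hl (Γ.const_speed l hl), a5⟩,
        H2Curve.tangent_eq_of_velocity_eq a3, H2Curve.tangent_eq_of_velocity_eq a4⟩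
  choose σ hσ hσw hσE using hall
  let Γs : ℕ → Network := fun n =>
    { curve := fun l => σ l n
      start_eq := fun l l' => by rw [(hσ l n).1, (hσ l' n).1]
      end_eq := fun l l' => by rw [(hσ l n).2.1, (hσ l' n).2.1]
      const_speed := fun l _ x hx => by
        obtain ⟨c, -, hc⟩ := (hσ l n).2.2.1
        rw [hc x hx, H2Curve.length_eq_of_const hc] }
  have hθ : ∀ n, (Γs n).IsTheta := fun n => by
    refine isTheta_of_inner (fun l => ?_) fun l l' hl => ⟨?_, ?_⟩
    · obtain ⟨c, hc0, hc⟩ := (hσ l n).2.2.1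
      exact H2Curve.regular_of_const hc0 hc
    · change inner ℝ ((σ l n).tangent 0) ((σ l' n).tangent 0) = (-1 / 2 : ℝ)
      rw [(hσ l n).2.2.2.1, (hσ l' n).2.2.2.1]
      refine inner_of_pair (T := fun l => if l = k then w else (Γ.curve l).tangent 0)
        hij hik hjk ?_ ?_ ?_ ?_ l l' hl
      · simpa only [if_neg hik] using ni 0 zero_mem_Icc
      · simpa only [if_neg hjk] using nj 0 zero_mem_Icc
      · simpa only [if_neg hik, if_neg hjk] using hin
      · simp only [if_neg hik, if_neg hjk, if_true, hw]
    · change inner ℝ ((σ l n).tangent 1) ((σ l' n).tangent 1) = (-1 / 2 : ℝ)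
      rw [(hσ l n).2.2.2.2, (hσ l' n).2.2.2.2]
      refine inner_of_pair (T := fun l => if l = k then w else (Γ.curve l).tangent 1)
        hij hik hjk ?_ ?_ ?_ ?_ l l' hl
      · simpa only [if_neg hik] using ni 1 one_mem_Icc
      · simpa only [if_neg hjk] using nj 1 one_mem_Icc
      · simpa only [if_neg hik, if_neg hjk] using hend.1
      · simp only [if_neg hik, if_neg hjk, if_true, hw, hend.2]
  refine ⟨Γs, hθ, fun l => hσw l, ?_⟩
  rw [h.extendedEnergy_eq hij hik hjk hi hj hk]
  refine ENNReal.tendsto_ofReal ?_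
  simp only [(hθ _).energy_eq]
  exact tendsto_finsetSum _ fun l _ => hσE l

/-- The lower bound: the curves of positive length contribute their energy to the limit. -/
theorem le_liminf_energy {Γs : ℕ → Network} {Γ : Network} (hθ : ∀ n, (Γs n).IsTheta)
    (hw : WeakConv Γs Γ) (E : Fin 3 → ℝ)
    (hE : ∀ i, (Γ.curve i).length ≠ 0 ∧ E i = (Γ.curve i).speedEnergy ∨ E i = 0) :
    ENNReal.ofReal (∑ i, E i) ≤ liminf (fun n => ENNReal.ofReal (Γs n).energy) atTop := by
  have hb : ∀ i, ∃ b : ℕ → ℝ,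
      (∀ n, b n ≤ ((Γs n).curve i).elasticEnergy + ((Γs n).curve i).length) ∧
      Tendsto b atTop (𝓝 (E i)) := by
    intro i
    rcases hE i with ⟨h0, hi⟩ | hi
    · rw [hi]
      exact (hw i).exists_minorant (fun n => (hθ n).norm_velocity i) (fun n => (hθ n).1 i) h0
    · rw [hi]
      exact ⟨fun _ => 0, fun n => add_nonneg (H2Curve.elasticEnergy_nonneg _)
        (H2Curve.length_nonneg _), tendsto_const_nhds⟩
  choose b hb hbt using hb
  rw [← (ENNReal.tendsto_ofReal (tendsto_finsetSum Finset.univ fun i _ => hbt i)).liminf_eq]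
  exact liminf_le_liminf (Eventually.of_forall fun n =>
    ENNReal.ofReal_le_ofReal (Finset.sum_le_sum fun i _ => hb i n))

theorem extendedEnergy_le_liminf {Γs : ℕ → Network} {Γ : Network} (hθ : ∀ n, (Γs n).IsTheta)
    (hw : WeakConv Γs Γ) :
    Γ.extendedEnergy ≤ liminf (fun n => ENNReal.ofReal (Γs n).energy) atTop := by
  by_cases h1 : Γ.IsTheta
  · rw [extendedEnergy, if_pos h1]
    exact le_liminf_energy hθ hw _ fun i => Or.inl ⟨(h1.length_pos i).ne', rfl⟩
  by_cases h2 : Γ.IsDegenerate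
  · obtain ⟨i, j, k, hij, hik, hjk, hi, hj, hk, -⟩ := id h2
    rw [h2.extendedEnergy_eq hij hik hjk hi hj hk]
    refine le_liminf_energy hθ hw _ fun l => ?_
    rcases eq_or_eq_or_eq hij hik hjk l with rfl | rfl | rfl
    · exact Or.inl ⟨(H2Curve.length_pos hi (Γ.const_speed _ hi)).ne', if_neg hik⟩
    · exact Or.inl ⟨(H2Curve.length_pos hj (Γ.const_speed _ hj)).ne', if_neg hjk⟩
    · exact Or.inr (if_pos rfl)
  · by_contra hlt
    obtain ⟨C, hC1, hC2⟩ := exists_between (not_le.1 hlt)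
    have hCt : C ≠ ⊤ := (hC2.trans_le le_top).ne
    obtain ⟨φ, hφ, hφC⟩ := extraction_of_frequently_atTop (frequently_lt_of_liminf_lt
      (by isBoundedDefault) hC1)
    have hw' : WeakConv (fun n => Γs (φ n)) Γ := fun i =>
      ⟨fun η hη => ((hw i).1 η hη).comp hφ.tendsto_atTop,
        fun η hη => ((hw i).2.1 η hη).comp hφ.tendsto_atTop,
        fun η hη => ((hw i).2.2 η hη).comp hφ.tendsto_atTop⟩
    exact (isTheta_or_isDegenerate_of_bounded (fun n => hθ (φ n)) hw' (C := C.toReal)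
      fun n => (ENNReal.ofReal_le_iff_le_toReal hCt).1 (hφC n).le).elim h1 h2

end Network

end ThetaNet

theorem mainTheorem4 :
    (∀ Γ : ThetaNet.Network, Γ.IsTheta → Γ.extendedEnergy = ENNReal.ofReal Γ.energy) ∧
    (∀ Γ : ThetaNet.Network,
      Γ.extendedEnergy =
        sInf {a : ENNReal | ∃ Γs : ℕ → ThetaNet.Network,
          (∀ n, (Γs n).IsTheta) ∧ ThetaNet.Network.WeakConv Γs Γ ∧
          a = Filter.liminf (fun n => ENNReal.ofReal (Γs n).energy) Filter.atTop}) ∧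
    (∀ Γ : ThetaNet.Network, Γ.IsDegenerate →
      ∃ Γs : ℕ → ThetaNet.Network,
        (∀ n, (Γs n).IsTheta) ∧ ThetaNet.Network.WeakConv Γs Γ ∧
        Filter.Tendsto (fun n => ENNReal.ofReal (Γs n).energy) Filter.atTop
          (nhds Γ.extendedEnergy)) := by
  refine ⟨fun Γ h => h.extendedEnergy_eq, fun Γ => le_antisymm ?_ ?_,
    fun Γ h => h.exists_recovery⟩
  · refine le_sInf ?_
    rintro a ⟨Γs, hθ, hw, rfl⟩
    exact ThetaNet.Network.extendedEnergy_le_liminf hθ hw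
  · by_cases h1 : Γ.IsTheta
    · refine sInf_le ⟨fun _ => Γ, fun _ => h1, fun i => ⟨fun η _ => tendsto_const_nhds,
        fun η _ => tendsto_const_nhds, fun η _ => tendsto_const_nhds⟩, ?_⟩
      rw [liminf_const, h1.extendedEnergy_eq]
    by_cases h2 : Γ.IsDegenerate
    · obtain ⟨Γs, hθ, hw, ht⟩ := h2.exists_recovery
      exact sInf_le ⟨Γs, hθ, hw, ht.liminf_eq.symm⟩
    · rw [ThetaNet.Network.extendedEnergy, if_neg h1, if_neg h2]
      exact le_top
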